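/- A \emph{weighted graph} $G=(V,E,a,b)$ consists of a set $V$ of vertices, a set $E$ of directed edges with source and terminal maps $\sigma,\tau:E\to V$ and a fixed-point-free involution $e\mapsto\check e$ with $\sigma(\check e)=\tau(e)$ (self-loops and multiple edges are allowed), edge weights $a:E\to\mathbb C$ with $a_{\check e}=\overline{a_e}$, and a potential $b:V\to\mathbb R$. Its Jacobi operator is $(A_G\eta)(u)=b_u\eta(u)+\sum_{e:\tau(e)=u}a_e\,\eta(\sigma(e))$, acting on $\ell^2(V)$. A graph is \emph{acyclic} if it has no closed non-backtracking walk, i.e. no sequence $e_1,\dots,e_\ell$ ($\ell\ge 1$) of directed edges with $\tau(e_s)=\sigma(e_{s+1})$ and $e_s\ne\check e_{s+1}$ for $1\le s<\ell$, and $\tau(e_\ell)=\sigma(e_1)$; a \emph{tree} is a connected acyclic graph. For $X\subset V$, let $\mathsf{cc}(X)$ be the number of connected components of the subgraph induced by $X$, and let $\partial X$ be the set of vertices outside $X$ that are joined to a vertex of $X$ by an edge. If $G$ is finite and connected, its \emph{universal cover} $\mathcal T$ is the tree (unique up to isomorphism) with a covering map $\Xi:\mathcal T\to G$, that is, a map of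 vertices and edges that respects $\sigma$, $\tau$ and edge reversal, preserves weights and potential, and is bijective on the edges leaving, and on the edges entering, each vertex. For $u\in V$ let $\mu_u$ be the spectral measure of the bounded self-adjoint operator $A_{\mathcal T}$ at $\delta_{\tilde u}$, for any vertex $\tilde u$ of $\mathcal T$ with $\Xi(\tilde u)=u$ (it does not depend on the choice of $\tilde u$), so that $\langle\delta_{\tilde u},f(A_{\mathcal T})\delta_{\tilde u}\rangle=\int f\,d\mu_u$; the \emph{density of states} of $A_{\mathcal T}$ is $\mu=\frac1{|V|}\sum_{u\in V}\mu_u$. \textbf{Theorem.} Let $G=(V,E,a,b)$ be a finite weighted graph, let $\lambda\in\mathbb R$, and let $X\subset V$ be such that the subgraph induced by $X$ is acyclic, $\lambda$ is an eigenvalue of the Jacobi operator of each connected component of this subgraph, and $\mathsf{cc}(X)-|\partial X|>0$. Then: (i) $\lambda$ is an eigenvalue of $A_G$, with multiplicity at least $\mathsf{cc}(X)-|\partial X|$. (ii) If $G$ is connected, with universal cover $\mathcal T$, then $\lambda$ is in the point spectrum of $A_{\mathcal T}$, i.e. $A_{\mathcal T}\eta=\lambda\eta$ for some nonzero $\eta\in\ell^2(V(\mathcal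 T))$, and the density of states $\mu$ of $A_{\mathcal T}$ satisfies $|V|\,\mu\{\lambda\}\ge\mathsf{cc}(X)-|\partial X|$. -/

import Mathlib

open scoped ENNReal ComplexConjugate lp CompactlySupported

/-- A weighted graph with self-loops and multiple edges allowed. `E` is the set of directed edges,
with a fixed-point-free direction reversal `rev`; the edge weights are complex with
`a (rev e) = conj (a e)`, the potential `b` is real. Each vertex meets finitely many edges
(automatic when `E` is finite). -/
structure WGraph (V : Type*) (E : Type*) where
  src : E → V
  tgt : E → V
  rev : E → E
  rev_rev : ∀ e, rev (rev e) = e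
  rev_ne : ∀ e, rev e ≠ e
  src_rev : ∀ e, src (rev e) = tgt e
  locallyFinite : ∀ u, {e | tgt e = u}.Finite
  a : E → ℂ
  a_rev : ∀ e, a (rev e) = conj (a e)
  b : V → ℝ

namespace WGraph

section Basic

variable {V E V' E' : Type*}

theorem tgt_rev (G : WGraph V E) (e : E) : G.tgt (G.rev e) = G.src e := by
  rw [← G.src_rev, G.rev_rev]

/-- The directed edges with terminal vertex `u`. -/
noncomputable def inEdges (G : WGraph V E) (u : V) : Finset E := (G.locallyFinite u).toFinset

@[simp] theorem mem_inEdges (G : WGraph V E) (u : V) (e : E) :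
    e ∈ G.inEdges u ↔ G.tgt e = u := by
  simp [inEdges]

/-- The formal Jacobi operator, on all functions on the vertices:
`(A η)(u) = b_u η(u) + ∑_{e : tgt e = u} a_e η(src e)`. -/
noncomputable def jacobi (G : WGraph V E) : (V → ℂ) →ₗ[ℂ] (V → ℂ) where
  toFun η u := (G.b u : ℂ) * η u + ∑ e ∈ G.inEdges u, G.a e * η (G.src e)
  map_add' η ζ := by
    funext u
    simp only [Pi.add_apply, mul_add, Finset.sum_add_distrib]
    ring
  map_smul' c η := by
    funext u
    simp only [Pi.smul_apply, smul_eq_mul, RingHom.id_apply, mul_add, Finset.mul_sum]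
    congr 1
    · ring
    · exact Finset.sum_congr rfl fun e _ => by ring

theorem jacobi_apply (G : WGraph V E) (η : V → ℂ) (u : V) :
    G.jacobi η u = (G.b u : ℂ) * η u + ∑ e ∈ G.inEdges u, G.a e * η (G.src e) := rfl

/-- The simple graph recording which distinct vertices are joined by an edge; it is used only for
connectedness and connected components. -/
def toSimple (G : WGraph V E) : SimpleGraph V where
  Adj u v := u ≠ v ∧ ∃ e, G.src e = u ∧ G.tgt e = v
  symm := ⟨by
    rintro u v ⟨hne, e, rfl, rfl⟩
    exact ⟨hne.symm, G.rev e, G.src_rev e, G.tgt_rev e⟩⟩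
  loopless := ⟨fun _ h => h.1 rfl⟩

def Connected (G : WGraph V E) : Prop := G.toSimple.Connected

/-- A nonempty sequence of directed edges forming a non-backtracking walk. -/
def IsNonbacktracking (G : WGraph V E) (w : List E) : Prop :=
  w.IsChain fun e f => G.tgt e = G.src f ∧ e ≠ G.rev f

/-- No closed non-backtracking walk. -/
def Acyclic (G : WGraph V E) : Prop :=
  ∀ (w : List E) (hw : w ≠ []), G.IsNonbacktracking w →
    G.src (w.head hw) ≠ G.tgt (w.getLast hw)

def IsTree (G : WGraph V E) : Prop := G.Connected ∧ G.Acyclic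

/-- The subgraph induced by a set of vertices, with the restricted weights and potential. -/
def induce (G : WGraph V E) (X : Set V) : WGraph X {e : E // G.src e ∈ X ∧ G.tgt e ∈ X} where
  src e := ⟨G.src e.1, e.2.1⟩
  tgt e := ⟨G.tgt e.1, e.2.2⟩
  rev e := ⟨G.rev e.1, by rw [G.src_rev, G.tgt_rev]; exact e.2.symm⟩
  rev_rev e := Subtype.ext (G.rev_rev e.1)
  rev_ne e h := G.rev_ne e.1 (congrArg Subtype.val h)
  src_rev e := Subtype.ext (G.src_rev e.1)
  locallyFinite u := by
    refine ((G.locallyFinite u.1).preimage Subtype.val_injective.injOn).subset ?_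
    intro e he
    exact congrArg Subtype.val he
  a e := G.a e.1
  a_rev e := G.a_rev e.1
  b u := G.b u.1

/-- The connected components of the subgraph induced by `X`. -/
abbrev Component (G : WGraph V E) (X : Set V) : Type _ := (G.induce X).toSimple.ConnectedComponent

/-- The number of connected components of the subgraph induced by `X`. -/
noncomputable def cc (G : WGraph V E) (X : Set V) : ℕ := Nat.card (G.Component X)

/-- The vertices outside `X` joined to a vertex of `X` by an edge. -/
def boundary (G : WGraph V E) (X : Set V) : Set V :=
  {v | v ∉ X ∧ ∃ e, G.src e ∈ X ∧ G.tgt e = v}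

/-- The sets `X` of vertices that induce an acyclic subgraph, each connected component of which
has `lam` as an eigenvalue of its induced Jacobi operator, and with `cc X - |∂X| > 0`. -/
def aomotoFamily (G : WGraph V E) (lam : ℝ) : Set (Set V) :=
  {X | (G.induce X).Acyclic ∧
    (∀ C : G.Component X,
      Module.End.HasEigenvalue ((G.induce X).induce C.supp).jacobi (lam : ℂ)) ∧
    0 < (G.cc X : ℤ) - (G.boundary X).ncard}

/-- A covering map: compatible with source, terminal vertex and reversal, preserving weights and
potential, and bijective on the edges out of and into each vertex. -/
structure Covering (H : WGraph V' E') (G : WGraph V E) where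
  onV : V' → V
  onE : E' → E
  src_onE : ∀ e, G.src (onE e) = onV (H.src e)
  tgt_onE : ∀ e, G.tgt (onE e) = onV (H.tgt e)
  rev_onE : ∀ e, G.rev (onE e) = onE (H.rev e)
  a_onE : ∀ e, G.a (onE e) = H.a e
  b_onV : ∀ v, G.b (onV v) = H.b v
  bijOn_src : ∀ v, Set.BijOn onE {e | H.src e = v} {e | G.src e = onV v}
  bijOn_tgt : ∀ v, Set.BijOn onE {e | H.tgt e = v} {e | G.tgt e = onV v}

theorem Covering.surjective {H : WGraph V' E'} {G : WGraph V E} (p : Covering H G)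
    (hH : H.Connected) (hG : G.Connected) : Function.Surjective p.onV := by
  obtain ⟨v₀⟩ := hH.nonempty
  intro u
  obtain ⟨w⟩ := hG.preconnected (p.onV v₀) u
  suffices h : ∀ {x y : V} (_ : G.toSimple.Walk x y) (v : V'), p.onV v = x →
      ∃ v', p.onV v' = y from h w v₀ rfl
  intro x y w
  induction w with
  | nil => exact fun v hv => ⟨v, hv⟩
  | cons hadj _ ih =>
    intro v hv
    obtain ⟨-, e, he, he'⟩ := hadj
    obtain ⟨f, hf, rfl⟩ := (p.bijOn_src v).surjOn (show G.src e = p.onV v by rw [he, hv])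
    exact ih (H.tgt f) (by rw [← p.tgt_onE, he'])

/-- Uniformly bounded degrees, weights and potential. -/
def IsBounded (G : WGraph V E) : Prop :=
  ∃ D : ℕ, (∀ u, (G.inEdges u).card ≤ D) ∧ (∀ e, ‖G.a e‖ ≤ D) ∧ ∀ u, |G.b u| ≤ D

theorem isBounded_of_finite [Finite V] (G : WGraph V E) : G.IsBounded := by
  classical
  have hE : Finite E := by
    have : (Set.univ : Set E) = ⋃ u : V, {e | G.tgt e = u} := by ext; simp
    exact Set.finite_univ_iff.1 (this ▸ Set.finite_iUnion G.locallyFinite)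
  obtain ⟨D₁, h₁⟩ := (Set.finite_range fun u => (G.inEdges u).card).bddAbove
  obtain ⟨D₂, h₂⟩ := (Set.finite_range fun e => ⌈‖G.a e‖⌉₊).bddAbove
  obtain ⟨D₃, h₃⟩ := (Set.finite_range fun u => ⌈|G.b u|⌉₊).bddAbove
  refine ⟨max D₁ (max D₂ D₃), fun u => ?_, fun e => ?_, fun u => ?_⟩
  · exact (h₁ ⟨u, rfl⟩).trans (le_max_left _ _)
  · exact (Nat.le_ceil _).trans (Nat.cast_le.2 ((h₂ ⟨e, rfl⟩).trans (by simp)))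
  · exact (Nat.le_ceil _).trans (Nat.cast_le.2 ((h₃ ⟨u, rfl⟩).trans (by simp)))

theorem Covering.isBounded [Finite V] {H : WGraph V' E'} {G : WGraph V E} (p : Covering H G) :
    H.IsBounded := by
  classical
  obtain ⟨D, h₁, h₂, h₃⟩ := G.isBounded_of_finite
  refine ⟨D, fun v => ?_, fun e => p.a_onE e ▸ h₂ _, fun v => p.b_onV v ▸ h₃ _⟩
  refine le_trans ?_ (h₁ (p.onV v))
  refine Finset.card_le_card_of_injOn p.onE ?_ ?_
  · intro e he
    simpa using (p.bijOn_tgt v).mapsTo (by simpa using he)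
  · intro e he f hf hef
    exact (p.bijOn_tgt v).injOn (by simpa using he) (by simpa using hf) hef

end Basic

section Hilbert

variable {V E : Type*}

theorem sum_inEdges_le (G : WGraph V E) {D : ℕ} (hD : ∀ u, (G.inEdges u).card ≤ D)
    (η : ℓ²(V, ℂ)) (s : Finset V) :
    ∑ u ∈ s, ∑ e ∈ G.inEdges u, ‖η (G.src e)‖ ^ 2 ≤ D * ‖η‖ ^ 2 := by
  classical
  have hη : ∀ t : Finset V, ∑ u ∈ t, ‖η u‖ ^ 2 ≤ ‖η‖ ^ 2 := fun t => by
    simpa using lp.sum_rpow_le_norm_rpow (p := 2) (by simp) η t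
  have hdisj : (s : Set V).PairwiseDisjoint G.inEdges := by
    intro u _ v _ huv
    refine Finset.disjoint_left.2 fun e he hf => huv ?_
    rw [mem_inEdges] at he hf
    rw [← he, hf]
  rw [← Finset.sum_biUnion hdisj]
  set F := s.biUnion G.inEdges
  rw [← Finset.sum_fiberwise_of_maps_to (t := F.image G.src) (g := G.src)
    (fun e he => Finset.mem_image_of_mem _ he)]
  calc _ ≤ ∑ v ∈ F.image G.src, D * ‖η v‖ ^ 2 := by
        refine Finset.sum_le_sum fun v _ => ?_
        rw [Finset.sum_congr rfl (g := fun _ => ‖η v‖ ^ 2)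
          (fun e he => by rw [(Finset.mem_filter.1 he).2]), Finset.sum_const, nsmul_eq_mul]
        gcongr
        refine le_trans ?_ (hD v)
        refine Finset.card_le_card_of_injOn G.rev ?_ ?_
        · intro e he
          have := (Finset.mem_filter.1 he).2
          simp [tgt_rev, this]
        · intro e _ f _ hef
          rw [← G.rev_rev e, hef, G.rev_rev]
    _ ≤ _ := by
        rw [← Finset.mul_sum]
        gcongr
        exact hη _

theorem exists_norm_jacobi_le (G : WGraph V E) (hG : G.IsBounded) :
    ∃ C : ℝ, 0 ≤ C ∧ ∀ (η : ℓ²(V, ℂ)) (s : Finset V),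
      ∑ u ∈ s, ‖G.jacobi η u‖ ^ (2 : ℝ≥0∞).toReal ≤ (C * ‖η‖) ^ (2 : ℝ≥0∞).toReal := by
  obtain ⟨D, h₁, h₂, h₃⟩ := hG
  refine ⟨√(2 * (D ^ 2 + D * (D ^ 2 * D))), Real.sqrt_nonneg _, fun η s => ?_⟩
  have hη : ∑ u ∈ s, ‖η u‖ ^ 2 ≤ ‖η‖ ^ 2 := by
    simpa using lp.sum_rpow_le_norm_rpow (p := 2) (by simp) η s
  have key : ∀ u, ‖G.jacobi η u‖ ^ 2 ≤
      2 * (D ^ 2 * ‖η u‖ ^ 2 + D * (D ^ 2 * ∑ e ∈ G.inEdges u, ‖η (G.src e)‖ ^ 2)) := by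
    intro u
    rw [jacobi_apply]
    have e1 : ‖(G.b u : ℂ) * η u‖ ≤ D * ‖η u‖ := by
      rw [norm_mul, Complex.norm_real, Real.norm_eq_abs]
      gcongr
      exact h₃ u
    have e2 : ‖∑ e ∈ G.inEdges u, G.a e * η (G.src e)‖ ^ 2
        ≤ D * (D ^ 2 * ∑ e ∈ G.inEdges u, ‖η (G.src e)‖ ^ 2) := by
      calc _ ≤ (∑ e ∈ G.inEdges u, D * ‖η (G.src e)‖) ^ 2 := by
            gcongr
            refine (norm_sum_le _ _).trans (Finset.sum_le_sum fun e _ => ?_)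
            rw [norm_mul]
            gcongr
            exact h₂ e
        _ ≤ (G.inEdges u).card * ∑ e ∈ G.inEdges u, (D * ‖η (G.src e)‖) ^ 2 :=
            sq_sum_le_card_mul_sum_sq
        _ ≤ _ := by
            simp only [mul_pow, ← Finset.mul_sum]
            gcongr
            exact h₁ u
    have e3 : ‖(G.b u : ℂ) * η u‖ ^ 2 ≤ D ^ 2 * ‖η u‖ ^ 2 := by
      rw [← mul_pow]
      gcongr
    calc _ ≤ (‖(G.b u : ℂ) * η u‖ + ‖∑ e ∈ G.inEdges u, G.a e * η (G.src e)‖) ^ 2 := by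
          gcongr
          exact norm_add_le _ _
      _ ≤ 2 * (‖(G.b u : ℂ) * η u‖ ^ 2 + ‖∑ e ∈ G.inEdges u, G.a e * η (G.src e)‖ ^ 2) :=
          add_sq_le
      _ ≤ _ := by gcongr
  simp only [ENNReal.toReal_ofNat, Real.rpow_ofNat]
  rw [mul_pow, Real.sq_sqrt (by positivity)]
  calc _ ≤ ∑ u ∈ s, 2 * ((D : ℝ) ^ 2 * ‖η u‖ ^ 2
          + D * (D ^ 2 * ∑ e ∈ G.inEdges u, ‖η (G.src e)‖ ^ 2)) :=
        Finset.sum_le_sum fun u _ => key u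
    _ = 2 * ((D : ℝ) ^ 2 * ∑ u ∈ s, ‖η u‖ ^ 2
          + D * (D ^ 2 * ∑ u ∈ s, ∑ e ∈ G.inEdges u, ‖η (G.src e)‖ ^ 2)) := by
        simp only [← Finset.mul_sum, Finset.sum_add_distrib]
    _ ≤ 2 * ((D : ℝ) ^ 2 * ‖η‖ ^ 2 + D * (D ^ 2 * (D * ‖η‖ ^ 2))) := by
        gcongr
        exact G.sum_inEdges_le h₁ η s
    _ = _ := by ring

/-- The Jacobi operator as a bounded operator on `ℓ²` of the vertices. -/
noncomputable def jacobiOp (G : WGraph V E) (hG : G.IsBounded) : ℓ²(V, ℂ) →L[ℂ] ℓ²(V, ℂ) :=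
  LinearMap.mkContinuousOfExistsBound
    { toFun := fun η => ⟨G.jacobi η, memℓp_gen' ((G.exists_norm_jacobi_le hG).choose_spec.2 η)⟩
      map_add' := fun η ζ => lp.ext (G.jacobi.map_add η ζ)
      map_smul' := fun c η => lp.ext (G.jacobi.map_smul c η) }
    (by
      obtain ⟨C, hC, h⟩ := G.exists_norm_jacobi_le hG
      exact ⟨C, fun η => lp.norm_le_of_forall_sum_le (by simp) (by positivity) (h η)⟩)

@[simp] theorem coe_jacobiOp (G : WGraph V E) (hG : G.IsBounded) (η : ℓ²(V, ℂ)) :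
    ⇑(G.jacobiOp hG η) = G.jacobi η := rfl

/-- The unit vector at the vertex `u`. -/
noncomputable def delta (u : V) : ℓ²(V, ℂ) :=
  open Classical in lp.single 2 u 1

theorem inner_delta (u : V) (η : ℓ²(V, ℂ)) : inner ℂ (delta u) η = η u := by
  classical
  have := lp.inner_single_left (𝕜 := ℂ) u (1 : ℂ) η
  simpa [delta] using this

theorem jacobiOp_delta (G : WGraph V E) (hG : G.IsBounded) (u : V) :
    G.jacobiOp hG (delta u) =
      (G.b u : ℂ) • delta u + ∑ e ∈ G.inEdges u, conj (G.a e) • delta (G.src e) := by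
  classical
  refine lp.ext (funext fun v => ?_)
  have hd : ∀ x y : V, (delta x : ℓ²(V, ℂ)) y = if x = y then 1 else 0 := by
    intro x y
    simp only [delta, lp.single_apply, Pi.single_apply, eq_comm]
  simp only [coe_jacobiOp, jacobi_apply, lp.coeFn_add, lp.coeFn_smul, lp.coeFn_sum, Pi.add_apply,
    Pi.smul_apply, Finset.sum_apply, smul_eq_mul, hd, mul_ite, mul_one, mul_zero]
  congr 1
  · split_ifs with h
    · rw [h]
    · rfl
  · rw [← Finset.sum_filter, ← Finset.sum_filter]
    refine Finset.sum_bij' (fun e _ => G.rev e) (fun e _ => G.rev e) ?_ ?_ ?_ ?_ ?_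
    · intro e he
      simp only [Finset.mem_filter, mem_inEdges] at he ⊢
      exact ⟨by rw [tgt_rev, he.2], by rw [G.src_rev, he.1]⟩
    · intro e he
      simp only [Finset.mem_filter, mem_inEdges] at he ⊢
      exact ⟨by rw [tgt_rev, he.2], by rw [G.src_rev, he.1]⟩
    · exact fun e _ => G.rev_rev e
    · exact fun e _ => G.rev_rev e
    · intro e _
      rw [G.a_rev, Complex.conj_conj]

theorem isSelfAdjoint_jacobiOp (G : WGraph V E) (hG : G.IsBounded) :
    IsSelfAdjoint (G.jacobiOp hG) := by
  rw [ContinuousLinearMap.isSelfAdjoint_iff']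
  ext η u
  rw [← inner_delta, ContinuousLinearMap.adjoint_inner_right, jacobiOp_delta, inner_add_left,
    sum_inner, inner_smul_left, inner_delta, coe_jacobiOp, jacobi_apply]
  simp [inner_smul_left, inner_delta]

end Hilbert

end WGraph

/-- The positive linear functional `f ↦ ⟨v, f(A) v⟩` on `C_c(ℝ, ℝ)`, where `f(A)` is the
continuous functional calculus of the (self-adjoint) bounded operator `A`. -/
noncomputable def spectralFunctional {H : Type*} [NormedAddCommGroup H] [InnerProductSpace ℂ H]
    [CompleteSpace H] (A : H →L[ℂ] H) (v : H) : C_c(ℝ, ℝ) →ₚ[ℝ] ℝ :=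
  PositiveLinearMap.mk₀
    { toFun := fun f => RCLike.re (inner ℂ v (cfc (f : ℝ → ℝ) A v))
      map_add' := fun f g => by
        have : cfc (⇑(f + g)) A = cfc (⇑f) A + cfc (⇑g) A :=
          cfc_add (R := ℝ) A f g f.continuous.continuousOn g.continuous.continuousOn
        rw [this, add_apply, inner_add_right, map_add]
      map_smul' := fun c f => by
        have : cfc (⇑(c • f)) A = c • cfc (⇑f) A :=
          cfc_smul (R := ℝ) c f A f.continuous.continuousOn
        rw [this, smul_apply, inner_smul_right_eq_smul]
        simp }
    (fun f hf => by
      have h : 0 ≤ cfc (f : ℝ → ℝ) A := cfc_nonneg fun x _ => hf x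
      exact ((ContinuousLinearMap.nonneg_iff_isPositive _).1 h).re_inner_nonneg_right v)

/-- The spectral measure of `A` at `v`: the Riesz measure of `f ↦ ⟨v, f(A) v⟩`. -/
noncomputable def spectralMeasure {H : Type*} [NormedAddCommGroup H] [InnerProductSpace ℂ H]
    [CompleteSpace H] (A : H →L[ℂ] H) (_hA : IsSelfAdjoint A) (v : H) : MeasureTheory.Measure ℝ :=
  RealRMK.rieszMeasure (spectralFunctional A v)

theorem integral_spectralMeasure {H : Type*} [NormedAddCommGroup H] [InnerProductSpace ℂ H]
    [CompleteSpace H] (A : H →L[ℂ] H) (hA : IsSelfAdjoint A) (v : H) (f : C_c(ℝ, ℝ)) :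
    ∫ x, f x ∂(spectralMeasure A hA v) = RCLike.re (inner ℂ v (cfc (f : ℝ → ℝ) A v)) :=
  RealRMK.integral_rieszMeasure _ f

namespace WGraph

variable {V E 𝒱 ℰ : Type*}

/-- `T`, together with the covering map `p`, is a universal cover of the connected graph `G`:
a tree covering `G`. -/
structure IsUniversalCover {T : WGraph 𝒱 ℰ} {G : WGraph V E} (p : Covering T G) : Prop where
  connected_base : G.Connected
  isTree : T.IsTree

/-- The periodic Jacobi operator `A_𝒯` on `ℓ²(𝒱)`. -/
noncomputable def periodicJacobi [Finite V] {T : WGraph 𝒱 ℰ} {G : WGraph V E}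
    (p : Covering T G) : ℓ²(𝒱, ℂ) →L[ℂ] ℓ²(𝒱, ℂ) :=
  T.jacobiOp p.isBounded

/-- The density of states of `A_𝒯`: the average over the vertices `u` of `G` of the spectral
measure at a vertex in the fibre over `u` (it does not depend on which one). -/
noncomputable def densityOfStates [Fintype V] {T : WGraph 𝒱 ℰ} {G : WGraph V E}
    (p : Covering T G) (hp : IsUniversalCover p) : MeasureTheory.Measure ℝ :=
  (Fintype.card V : ℝ≥0∞)⁻¹ • ∑ u : V,
    spectralMeasure (periodicJacobi p) (T.isSelfAdjoint_jacobiOp p.isBounded)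
      (delta (Function.surjInv (p.surjective hp.isTree.1 hp.connected_base) u))

end WGraph

namespace WGraph

section WalkTree

variable {V E : Type*}

/-- The last vertex of a walk from `r`, given as the list of its edges, last edge first. -/
def endpt (G : WGraph V E) (r : V) : List E → V
  | [] => r
  | e :: _ => G.tgt e

/-- Non-backtracking walks from `r`, given as the list of their edges, last edge first. -/
def IsWalkFrom (G : WGraph V E) (r : V) : List E → Prop
  | [] => True
  | e :: l => G.IsWalkFrom r l ∧ G.src e = G.endpt r l ∧ l.head? ≠ some (G.rev e)

/-- Follow the edge `e` after the walk `l`, cancelling a backtracking. -/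
noncomputable def step (G : WGraph V E) (l : List E) (e : E) : List E :=
  open Classical in if l.head? = some (G.rev e) then l.tail else e :: l

theorem step_up (G : WGraph V E) {l : List E} {e : E} (h : l.head? ≠ some (G.rev e)) :
    G.step l e = e :: l := if_neg h

theorem step_down (G : WGraph V E) (l : List E) (e : E) : G.step (G.rev e :: l) e = l :=
  if_pos rfl

theorem step_cases (G : WGraph V E) (l : List E) (e : E) :
    (∃ l', l = G.rev e :: l') ∨ l.head? ≠ some (G.rev e) := by
  cases l with
  | nil => simp
  | cons f l => simp only [List.cons.injEq, List.head?_cons, ne_eq, Option.some.injEq]; grind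

variable (G : WGraph V E) (r : V)

theorem isWalkFrom_step {l : List E} {e : E} (hl : G.IsWalkFrom r l)
    (he : G.src e = G.endpt r l) : G.IsWalkFrom r (G.step l e) := by
  rcases G.step_cases l e with ⟨l', rfl⟩ | h
  · rw [step_down]; exact hl.1
  · rw [step_up G h]; exact ⟨hl, he, h⟩

theorem endpt_step {l : List E} {e : E} (hl : G.IsWalkFrom r l) :
    G.endpt r (G.step l e) = G.tgt e := by
  rcases G.step_cases l e with ⟨l', rfl⟩ | h
  · rw [step_down, ← hl.2.1, G.src_rev]
  · rw [step_up G h]; rfl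

theorem step_step {l : List E} {e : E} (hl : G.IsWalkFrom r l) :
    G.step (G.step l e) (G.rev e) = l := by
  rcases G.step_cases l e with ⟨l', rfl⟩ | h
  · rw [step_down, step_up]; exact hl.2.2
  · rw [step_up G h]
    conv_lhs => rw [← G.rev_rev e]
    rw [G.rev_rev (G.rev e)]
    exact G.step_down l (G.rev e)

/-- The vertices of the tree of non-backtracking walks from `r`. -/
abbrev WalkVertex : Type _ := {l : List E // G.IsWalkFrom r l}

/-- The directed edges of the tree of non-backtracking walks from `r`. -/
abbrev WalkEdge : Type _ := {x : G.WalkVertex r × E // G.src x.2 = G.endpt r x.1.1}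

noncomputable def walkTgt (x : G.WalkEdge r) : G.WalkVertex r :=
  ⟨G.step x.1.1.1 x.1.2, G.isWalkFrom_step r x.1.1.2 x.2⟩

noncomputable def walkRev (x : G.WalkEdge r) : G.WalkEdge r :=
  ⟨(G.walkTgt r x, G.rev x.1.2), by
    rw [G.src_rev]; exact (G.endpt_step r x.1.1.2).symm⟩

theorem walkRev_walkRev (x : G.WalkEdge r) : G.walkRev r (G.walkRev r x) = x := by
  refine Subtype.ext (Prod.ext (Subtype.ext ?_) (G.rev_rev _))
  exact G.step_step r x.1.1.2

/-- The tree of non-backtracking walks from `r`, two walks being joined by an edge when one is the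
other followed by one more edge. -/
noncomputable def walkTree : WGraph (G.WalkVertex r) (G.WalkEdge r) where
  src x := x.1.1
  tgt := G.walkTgt r
  rev := G.walkRev r
  rev_rev := G.walkRev_walkRev r
  rev_ne x h := G.rev_ne x.1.2 (congrArg (fun y => y.1.2) h)
  src_rev _ := rfl
  locallyFinite l := by
    refine Set.Finite.of_finite_image (f := fun x : G.WalkEdge r => x.1.2)
      ((G.locallyFinite (G.endpt r l.1)).subset ?_) ?_
    · rintro _ ⟨x, rfl, rfl⟩
      exact (G.endpt_step r x.1.1.2).symm
    · rintro x rfl y hy hxy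
      have h : G.walkRev r x = G.walkRev r y :=
        Subtype.ext (Prod.ext hy.symm (congrArg G.rev hxy))
      rw [← G.walkRev_walkRev r x, h, G.walkRev_walkRev]
  a x := G.a x.1.2
  a_rev x := G.a_rev x.1.2
  b l := G.b (G.endpt r l.1)

noncomputable def walkCovering : Covering (G.walkTree r) G where
  onV l := G.endpt r l.1
  onE x := x.1.2
  src_onE x := x.2
  tgt_onE x := (G.endpt_step r x.1.1.2).symm
  rev_onE _ := rfl
  a_onE _ := rfl
  b_onV _ := rfl
  bijOn_src l := by
    refine ⟨?_, ?_, fun e he => ⟨⟨(l, e), he⟩, rfl, rfl⟩⟩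
    · rintro x rfl; exact x.2
    · rintro x rfl y hy hxy
      exact Subtype.ext (Prod.ext hy.symm hxy)
  bijOn_tgt l := by
    refine ⟨?_, ?_, fun e he => ?_⟩
    · rintro x rfl; exact (G.endpt_step r x.1.1.2).symm
    · rintro x rfl y hy hxy
      have h : G.walkRev r x = G.walkRev r y :=
        Subtype.ext (Prod.ext hy.symm (congrArg G.rev hxy))
      rw [← G.walkRev_walkRev r x, h, G.walkRev_walkRev]
    · let y : G.WalkEdge r := ⟨(l, G.rev e), by rw [G.src_rev]; exact he⟩
      have h : G.walkTgt r (G.walkRev r y) = l :=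
        congrArg (fun z : G.WalkEdge r => z.1.1) (G.walkRev_walkRev r y)
      exact ⟨G.walkRev r y, h, G.rev_rev e⟩

theorem walkTree_connected : (G.walkTree r).Connected := by
  have h : ∀ (l : List E) (hl : G.IsWalkFrom r l),
      (G.walkTree r).toSimple.Reachable ⟨[], trivial⟩ ⟨l, hl⟩ := by
    intro l
    induction l with
    | nil => exact fun _ => SimpleGraph.Reachable.refl _
    | cons e l ih =>
      intro hl
      refine (ih hl.1).trans (SimpleGraph.Adj.reachable ⟨?_, ⟨(⟨l, hl.1⟩, e), hl.2.1⟩, rfl, ?_⟩)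
      · intro h
        have := congrArg (fun z => z.1.length) h
        simp at this
      · exact Subtype.ext (G.step_up hl.2.2)
  have : Nonempty (G.WalkVertex r) := ⟨⟨[], trivial⟩⟩
  exact SimpleGraph.Connected.mk fun x y => (h x.1 x.2).symm.trans (h y.1 y.2)

theorem walkTree_suffix (w : List (G.WalkEdge r)) :
    ∀ x : G.WalkEdge r, (G.walkTree r).IsNonbacktracking (x :: w) →
      (x.1.1.1.head? ≠ some (G.rev x.1.2) →
        x.1.2 :: x.1.1.1 <:+ ((G.walkTree r).tgt ((x :: w).getLast (by simp))).1) ∧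
      (x.1.1.1.head? = some (G.rev x.1.2) →
        ¬ x.1.1.1 <:+ ((G.walkTree r).tgt ((x :: w).getLast (by simp))).1) := by
  induction w with
  | nil =>
    intro x _
    refine ⟨fun h => ?_, fun h => ?_⟩
    · change _ <:+ G.step x.1.1.1 x.1.2
      rw [G.step_up h]
    · rcases G.step_cases x.1.1.1 x.1.2 with ⟨l', hl'⟩ | h'
      · intro hs
        have hs : x.1.1.1 <:+ G.step x.1.1.1 x.1.2 := hs
        rw [hl', step_down] at hs
        simpa using hs.length_le
      · exact absurd h h'
  | cons y w ih =>
    intro x hw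
    obtain ⟨⟨hxy, hne⟩, hw'⟩ := List.isChain_cons_cons.1 hw
    obtain ⟨h₁, h₂⟩ := ih y hw'
    have hy : y.1.1.1 = G.step x.1.1.1 x.1.2 := (congrArg Subtype.val hxy).symm
    have hne' : y.1.2 ≠ G.rev x.1.2 := by
      intro h
      apply hne
      rw [← G.walkRev_walkRev r x]
      refine congrArg (G.walkRev r) (Subtype.ext (Prod.ext hxy h.symm))
    rw [List.getLast_cons (by simp)]
    refine ⟨fun h => ?_, fun h hs => ?_⟩
    · rw [step_up G h] at hy
      refine (List.suffix_cons y.1.2 _).trans (hy ▸ h₁ ?_)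
      rw [hy]
      intro h'
      rw [List.head?_cons, Option.some.injEq] at h'
      exact hne' (by rw [h', G.rev_rev])
    · rcases G.step_cases x.1.1.1 x.1.2 with ⟨l', hl'⟩ | h'
      · rw [hl', step_down] at hy
        rw [hl'] at hs
        by_cases hy' : y.1.1.1.head? = some (G.rev y.1.2)
        · exact h₂ hy' (hy ▸ (List.suffix_cons _ _).trans hs)
        · have := h₁ hy'
          rw [hy] at this
          have := (List.suffix_of_suffix_length_le this hs (by simp)).eq_of_length (by simp)
          exact hne' (List.cons.inj this).1
      · exact h' h

theorem walkTree_acyclic : (G.walkTree r).Acyclic := by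
  intro w hw hnb hclosed
  obtain ⟨x, w, rfl⟩ := List.exists_cons_of_ne_nil hw
  obtain ⟨h₁, h₂⟩ := G.walkTree_suffix r w x hnb
  rw [← hclosed] at h₁ h₂
  by_cases h : x.1.1.1.head? = some (G.rev x.1.2)
  · exact h₂ h (List.suffix_refl _)
  · have := (h₁ h).length_le
    simp [walkTree] at this

/-- Every connected graph has a universal cover, the tree of non-backtracking walks. -/
theorem isUniversalCover_walkCovering (hG : G.Connected) : IsUniversalCover (G.walkCovering r) :=
  ⟨hG, G.walkTree_connected r, G.walkTree_acyclic r⟩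

end WalkTree

end WGraph

/-!
A component `C` of the subgraph induced by `X` carries a `lam`-eigenfunction of its own Jacobi
operator. Extended by zero, it satisfies the eigenvalue equation of `G` except at the vertices of
`∂X`. These functions have disjoint supports, so they span a space of dimension `cc X`, and
`|∂X|` linear conditions select eigenfunctions of `G`: this is the multiplicity bound
`cc_sub_boundary_le_finrank` for finite graphs.

The statement on the universal cover `T` is obtained by approximating `T` by finite covers of `G`,
whose number of sheets is written `N`.

* `G` has finite covers `H` without closed non-backtracking walks of length at most any given `n`
  (`exists_finite_covering`). They come from iterating the mod 2 homology cover: a closed walk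
  lifts to a closed walk only if it crosses every undirected edge an even number of times, and a
  closed non-backtracking walk of minimal length crosses its first edge only once.
* Since the subgraph induced by `X` is acyclic, each of its components lifts to at least `N`
  components in `H`, while the boundary of the preimage has exactly `N |∂X|` elements. The finite
  bound for `H` then gives an eigenspace of dimension at least `N (cc X - |∂X|)`
  (`Covering.mul_cc_sub_boundary_le_finrank`).
* The diagonal entries of a polynomial in the Jacobi operator of `H` agree with those of `T` once
  `H` has no cycle as short as the degree: both are diagonal entries for the tree of
  non-backtracking walks of `G` (`Covering.jacobi_pow_single`).

The polynomials used are the powers of `1 - (t - lam)² / M²`, with `M` larger than the norm of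
`A_T - lam`. On `H` they act as the identity on the eigenspace, so Bessel's inequality bounds its
dimension by a sum of squared norms; transferred to `T`, this reads
`cc X - |∂X| ≤ ∑ u, ‖(1 - (A_T - lam)² / M²) ^ m δ_u‖²` for all `m`. As `m` tends to infinity, the
vectors on the right converge to the projections of `δ_u` to the kernel of `A_T - lam`
(`exists_ker_tendsto_norm_kernelFilter`), whose squared norms are at most the masses of the
spectral measures at `lam` (`ofReal_norm_sq_le_spectralMeasure`).
-/

namespace WGraph

/-! ### Coverings and non-backtracking walks -/

section Coverings

variable {V E V' E' V'' E'' : Type*}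

/-- The Jacobi operator at `u` sees only `u` and its neighbours. -/
theorem jacobi_congr (G : WGraph V E) {η ζ : V → ℂ} {u : V} (hu : η u = ζ u)
    (h : ∀ e, G.tgt e = u → η (G.src e) = ζ (G.src e)) : G.jacobi η u = G.jacobi ζ u := by
  rw [jacobi_apply, jacobi_apply, hu]
  congr 1
  exact Finset.sum_congr rfl fun e he => by rw [h e (by simpa using he)]

/-- For maps that respect reversal, bijectivity on outgoing edges gives bijectivity on incoming
edges. -/
theorem bijOn_tgt_of_bijOn_src {H : WGraph V' E'} {G : WGraph V E} {onV : V' → V} {onE : E' → E}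
    (hrev : ∀ e, G.rev (onE e) = onE (H.rev e))
    (h : ∀ v, Set.BijOn onE {e | H.src e = v} {e | G.src e = onV v}) (v : V') :
    Set.BijOn onE {e | H.tgt e = v} {e | G.tgt e = onV v} := by
  have hH : ∀ e, H.tgt e = H.src (H.rev e) := fun e => (H.src_rev e).symm
  have hG : ∀ e, G.tgt e = G.src (G.rev e) := fun e => (G.src_rev e).symm
  refine ⟨fun e he => ?_, fun e he f hf hef => ?_, fun e he => ?_⟩
  · have := (h v).mapsTo (show H.src (H.rev e) = v by rw [← hH]; exact he)
    rw [← hrev] at this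
    exact (hG _).trans this
  · have := (h v).injOn (show H.src (H.rev e) = v by rw [← hH]; exact he)
      (show H.src (H.rev f) = v by rw [← hH]; exact hf) (by rw [← hrev, ← hrev, hef])
    rw [← H.rev_rev e, this, H.rev_rev]
  · obtain ⟨f, hf, hfe⟩ := (h v).surjOn (show G.src (G.rev e) = onV v by rw [← hG]; exact he)
    exact ⟨H.rev f, (H.tgt_rev f).trans hf, by rw [← hrev, hfe, G.rev_rev]⟩

/-- Coverings intertwine the Jacobi operators. -/
theorem Covering.jacobi_comp {H : WGraph V' E'} {G : WGraph V E} (p : Covering H G) (f : V → ℂ) :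
    H.jacobi (f ∘ p.onV) = G.jacobi f ∘ p.onV := by
  funext v
  simp only [jacobi_apply, Function.comp_apply, p.b_onV]
  congr 1
  have h := p.bijOn_tgt v
  refine Finset.sum_bij (fun e _ => p.onE e) ?_ ?_ ?_ ?_
  · intro e he
    simpa using h.mapsTo (by simpa using he)
  · intro e he f hf hef
    exact h.injOn (by simpa using he) (by simpa using hf) hef
  · intro e he
    obtain ⟨f, hf, hfe⟩ := h.surjOn (show G.tgt e = p.onV v by simpa using he)
    exact ⟨f, by simpa using hf, hfe⟩
  · intro e _
    rw [p.a_onE, p.src_onE]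

theorem Covering.jacobi_pow_comp {H : WGraph V' E'} {G : WGraph V E} (p : Covering H G) (k : ℕ)
    (f : V → ℂ) : (H.jacobi ^ k) (f ∘ p.onV) = (G.jacobi ^ k) f ∘ p.onV := by
  induction k with
  | zero => rfl
  | succ k ih => rw [pow_succ', pow_succ', Module.End.mul_apply, ih, p.jacobi_comp]; rfl

/-- The composition of two coverings. -/
def Covering.comp {K : WGraph V'' E''} {H : WGraph V' E'} {G : WGraph V E} (p : Covering H G)
    (q : Covering K H) : Covering K G where
  onV := p.onV ∘ q.onV
  onE := p.onE ∘ q.onE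
  src_onE e := by simp [p.src_onE, q.src_onE]
  tgt_onE e := by simp [p.tgt_onE, q.tgt_onE]
  rev_onE e := by simp [p.rev_onE, q.rev_onE]
  a_onE e := by simp [p.a_onE, q.a_onE]
  b_onV e := by simp [p.b_onV, q.b_onV]
  bijOn_src v := (p.bijOn_src _).comp (q.bijOn_src v)
  bijOn_tgt v := (p.bijOn_tgt _).comp (q.bijOn_tgt v)

/-- The restriction of a covering to the subgraph induced by the preimage of `X`. -/
def Covering.induce {H : WGraph V' E'} {G : WGraph V E} (p : Covering H G) (X : Set V) :
    Covering (H.induce (p.onV ⁻¹' X)) (G.induce X) where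
  onV v := ⟨p.onV v.1, v.2⟩
  onE e := ⟨p.onE e.1, by rw [p.src_onE, p.tgt_onE]; exact e.2⟩
  src_onE e := Subtype.ext (p.src_onE e.1)
  tgt_onE e := Subtype.ext (p.tgt_onE e.1)
  rev_onE e := Subtype.ext (p.rev_onE e.1)
  a_onE e := p.a_onE e.1
  b_onV v := p.b_onV v.1
  bijOn_src v := by
    refine ⟨fun e he => ?_, fun e he f hf hef => ?_, fun e he => ?_⟩
    · exact Subtype.ext ((p.src_onE e.1).trans (congrArg p.onV (congrArg Subtype.val he)))
    · exact Subtype.ext ((p.bijOn_src v.1).injOn (congrArg Subtype.val he)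
        (congrArg Subtype.val hf) (congrArg Subtype.val hef))
    · obtain ⟨f, hf, hfe⟩ := (p.bijOn_src v.1).surjOn (congrArg Subtype.val he)
      refine ⟨⟨f, ?_, ?_⟩, Subtype.ext hf, Subtype.ext hfe⟩
      · rw [Set.mem_preimage, ← p.src_onE, hfe]; exact e.2.1
      · rw [Set.mem_preimage, ← p.tgt_onE, hfe]; exact e.2.2
  bijOn_tgt v := by
    refine ⟨fun e he => ?_, fun e he f hf hef => ?_, fun e he => ?_⟩
    · exact Subtype.ext ((p.tgt_onE e.1).trans (congrArg p.onV (congrArg Subtype.val he)))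
    · exact Subtype.ext ((p.bijOn_tgt v.1).injOn (congrArg Subtype.val he)
        (congrArg Subtype.val hf) (congrArg Subtype.val hef))
    · obtain ⟨f, hf, hfe⟩ := (p.bijOn_tgt v.1).surjOn (congrArg Subtype.val he)
      refine ⟨⟨f, ?_, ?_⟩, Subtype.ext hf, Subtype.ext hfe⟩
      · rw [Set.mem_preimage, ← p.src_onE, hfe]; exact e.2.1
      · rw [Set.mem_preimage, ← p.tgt_onE, hfe]; exact e.2.2

/-- There is no closed non-backtracking walk of length at most `n`. -/
def NoCycleUpTo (G : WGraph V E) (n : ℕ) : Prop :=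
  ∀ (w : List E) (hw : w ≠ []), w.length ≤ n → G.IsNonbacktracking w →
    G.src (w.head hw) ≠ G.tgt (w.getLast hw)

theorem Acyclic.noCycleUpTo {G : WGraph V E} (hG : G.Acyclic) (n : ℕ) : G.NoCycleUpTo n :=
  fun w hw _ => hG w hw

theorem endpt_of_ne_nil (G : WGraph V E) (r : V) {l : List E} (hl : l ≠ []) :
    G.endpt r l = G.tgt (l.head hl) := by
  cases l with
  | nil => exact absurd rfl hl
  | cons e l => rfl

theorem IsWalkFrom.src_getLast {G : WGraph V E} {r : V} {l : List E} (h : G.IsWalkFrom r l)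
    (hl : l ≠ []) : G.src (l.getLast hl) = r := by
  induction l with
  | nil => exact absurd rfl hl
  | cons e l ih =>
    by_cases h' : l = []
    · subst h'; exact h.2.1
    · rw [List.getLast_cons h']; exact ih h.1 h'

theorem IsWalkFrom.isNonbacktracking_reverse {G : WGraph V E} {r : V} {l : List E}
    (h : G.IsWalkFrom r l) : G.IsNonbacktracking l.reverse := by
  rw [IsNonbacktracking, List.isChain_reverse]
  induction l with
  | nil => exact List.isChain_nil
  | cons e l ih =>
    cases l with
    | nil => exact List.isChain_singleton _
    | cons f l =>
      refine List.isChain_cons_cons.2 ⟨⟨h.2.1.symm, ?_⟩, ih h.1⟩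
      have := h.2.2
      simpa using this

/-- Without short cycles, a short non-backtracking walk that returns to its origin is empty. -/
theorem NoCycleUpTo.eq_nil {G : WGraph V E} {n : ℕ} (hG : G.NoCycleUpTo n) {r : V} {l : List E}
    (h : G.IsWalkFrom r l) (hn : l.length ≤ n) (hr : G.endpt r l = r) : l = [] := by
  by_contra hl
  have hl' : l.reverse ≠ [] := by simpa using hl
  refine hG l.reverse hl' (by simpa using hn) h.isNonbacktracking_reverse ?_
  rw [List.head_reverse, List.getLast_reverse, h.src_getLast hl, ← G.endpt_of_ne_nil r hl, hr]

/-- Every vertex reachable from `r` is the endpoint of a non-backtracking walk from `r`. -/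
theorem exists_isWalkFrom (G : WGraph V E) {r v : V} (h : G.toSimple.Reachable r v) :
    ∃ l, G.IsWalkFrom r l ∧ G.endpt r l = v := by
  obtain ⟨w⟩ := h
  suffices h : ∀ {x y : V} (_ : G.toSimple.Walk x y) (l : List E), G.IsWalkFrom r l →
      G.endpt r l = x → ∃ l, G.IsWalkFrom r l ∧ G.endpt r l = y from h w [] trivial rfl
  intro x y w
  induction w with
  | nil => exact fun l hl hx => ⟨l, hl, hx⟩
  | cons hadj _ ih =>
    intro l hl hx
    obtain ⟨-, e, he, he'⟩ := hadj
    exact ih _ (G.isWalkFrom_step r hl (he.trans hx.symm)) ((G.endpt_step r hl).trans he')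

section MapWalk

variable {H : WGraph V' E'} {G : WGraph V E} (p : Covering H G) {x : V'}

theorem Covering.endpt_map (l : List E') :
    G.endpt (p.onV x) (l.map p.onE) = p.onV (H.endpt x l) := by
  cases l with
  | nil => rfl
  | cons e l => exact p.tgt_onE e

theorem Covering.head?_map_eq_iff {l : List E'} {e : E'} (he : H.src e = H.endpt x l) :
    (l.map p.onE).head? = some (G.rev (p.onE e)) ↔ l.head? = some (H.rev e) := by
  cases l with
  | nil => simp
  | cons f l =>
    simp only [List.map_cons, List.head?_cons, Option.some.injEq, p.rev_onE]
    refine ⟨fun h => ?_, fun h => by rw [h]⟩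
    exact (p.bijOn_tgt (H.src e)).injOn (show H.tgt f = H.src e from he.symm) (H.tgt_rev e) h

theorem Covering.isWalkFrom_map {l : List E'} (hl : H.IsWalkFrom x l) :
    G.IsWalkFrom (p.onV x) (l.map p.onE) := by
  induction l with
  | nil => trivial
  | cons e l ih =>
    refine ⟨ih hl.1, ?_, ?_⟩
    · rw [p.endpt_map, p.src_onE, hl.2.1]
    · rw [Ne, p.head?_map_eq_iff hl.2.1]; exact hl.2.2

theorem Covering.step_map {l : List E'} {e : E'} (he : H.src e = H.endpt x l) :
    G.step (l.map p.onE) (p.onE e) = (H.step l e).map p.onE := by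
  have := p.head?_map_eq_iff he
  by_cases h : l.head? = some (H.rev e)
  · rw [step, step, if_pos h, if_pos (this.2 h), List.map_tail]
  · rw [step, step, if_neg h, if_neg (fun h' => h (this.1 h')), List.map_cons]

/-- A covering maps the walk tree at `x` onto the walk tree at the image of `x`. -/
noncomputable def Covering.mapWalkTree (x : V') :
    Covering (H.walkTree x) (G.walkTree (p.onV x)) where
  onV l := ⟨l.1.map p.onE, p.isWalkFrom_map l.2⟩
  onE y := ⟨(⟨y.1.1.1.map p.onE, p.isWalkFrom_map y.1.1.2⟩, p.onE y.1.2), by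
    rw [p.endpt_map, p.src_onE, y.2]⟩
  src_onE _ := rfl
  tgt_onE y := Subtype.ext (p.step_map y.2)
  rev_onE y := Subtype.ext (Prod.ext (Subtype.ext (p.step_map y.2)) (p.rev_onE _))
  a_onE y := p.a_onE _
  b_onV l := by
    change G.b (G.endpt _ (l.1.map p.onE)) = H.b (H.endpt _ l.1)
    rw [p.endpt_map, p.b_onV]
  bijOn_src := mapWalkTree_bijOn
  bijOn_tgt := bijOn_tgt_of_bijOn_src
    (fun y => Subtype.ext (Prod.ext (Subtype.ext (p.step_map y.2)) (p.rev_onE _)))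
    mapWalkTree_bijOn
where
  mapWalkTree_bijOn (l : H.WalkVertex x) : Set.BijOn
      (fun y : H.WalkEdge x => (⟨(⟨y.1.1.1.map p.onE, p.isWalkFrom_map y.1.1.2⟩, p.onE y.1.2), by
        rw [p.endpt_map, p.src_onE, y.2]⟩ : G.WalkEdge (p.onV x)))
      {y | (H.walkTree x).src y = l}
      {y | (G.walkTree (p.onV x)).src y = ⟨l.1.map p.onE, p.isWalkFrom_map l.2⟩} := by
    refine ⟨?_, ?_, ?_⟩
    · rintro y rfl; rfl
    · rintro y rfl z hz hyz
      have h2 : p.onE y.1.2 = p.onE z.1.2 := congrArg (fun t : G.WalkEdge _ => t.1.2) hyz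
      have hz' : z.1.1 = y.1.1 := hz
      exact Subtype.ext (Prod.ext hz'.symm ((p.bijOn_src _).injOn y.2
        (show H.src z.1.2 = _ by rw [z.2, hz']) h2))
    · rintro ⟨⟨m, e⟩, he⟩ hm
      change m = _ at hm
      subst hm
      dsimp only at he
      rw [p.endpt_map] at he
      obtain ⟨f, hf, rfl⟩ := (p.bijOn_src _).surjOn he
      exact ⟨⟨(l, f), hf⟩, rfl, rfl⟩

end MapWalk

/-! ### Diagonal entries of powers of the Jacobi operator -/

theorem walkTree_length_src_le (G : WGraph V E) (r : V) (y : G.WalkEdge r) :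
    ((G.walkTree r).src y).1.length ≤ ((G.walkTree r).tgt y).1.length + 1 := by
  have h : (G.walkTree r).src y = G.walkTgt r (G.walkRev r y) :=
    (congrArg (fun z : G.WalkEdge r => z.1.1) (G.walkRev_walkRev r y)).symm
  rw [h]
  change (G.step (G.walkTgt r y).1 _).length ≤ (G.walkTgt r y).1.length + 1
  unfold step
  split_ifs
  · rw [List.length_tail]; omega
  · simp

theorem walkTree_jacobi_pow_congr (G : WGraph V E) (r : V) (k : ℕ) :
    ∀ (m : ℕ) {f g : G.WalkVertex r → ℂ}, (∀ l, l.1.length ≤ m + k → f l = g l) →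
      ∀ l : G.WalkVertex r, l.1.length ≤ m →
        ((G.walkTree r).jacobi ^ k) f l = ((G.walkTree r).jacobi ^ k) g l := by
  induction k with
  | zero => exact fun m f g h l hl => h l hl
  | succ k ih =>
    intro m f g h l hl
    rw [pow_succ', Module.End.mul_apply, Module.End.mul_apply]
    have h' := ih (m + 1) (f := f) (g := g) fun l hl => h l (by omega)
    refine jacobi_congr _ (h' l (by omega)) fun e he => h' _ ?_
    have := G.walkTree_length_src_le r e
    rw [he] at this
    omega

open Classical in
/-- If `H` covers `G` and has no cycle of length at most `k`, the diagonal entries of the `k`-th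
power of its Jacobi operator are those of the tree of non-backtracking walks of `G`; they depend
only on the image of the vertex in `G`. -/
theorem Covering.jacobi_pow_single {H : WGraph V' E'} {G : WGraph V E} (p : Covering H G)
    {k : ℕ} (hH : H.NoCycleUpTo k) (x : V') :
    (H.jacobi ^ k) (Pi.single x 1) x =
      ((G.walkTree (p.onV x)).jacobi ^ k) (Pi.single ⟨[], trivial⟩ 1) ⟨[], trivial⟩ := by
  have h₁ := congrFun ((H.walkCovering x).jacobi_pow_comp k (Pi.single x 1)) ⟨[], trivial⟩
  have h₂ := congrFun ((p.mapWalkTree x).jacobi_pow_comp k (Pi.single ⟨[], trivial⟩ 1))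
    ⟨[], trivial⟩
  refine h₁.symm.trans (Eq.trans ?_ h₂)
  refine H.walkTree_jacobi_pow_congr x k 0 (fun l hl => ?_) _ le_rfl
  simp only [Function.comp_apply, Pi.single_apply]
  refine if_congr ⟨fun h => ?_, fun h => ?_⟩ rfl rfl
  · have : l.1 = [] := hH.eq_nil l.2 (by omega) h
    exact Subtype.ext (by simp [mapWalkTree, this])
  · have : l.1.map p.onE = [] := congrArg Subtype.val h
    have : l.1 = [] := by simpa using this
    change H.endpt x l.1 = x
    rw [this]; rfl

end Coverings

/-! ### Finite covers without short cycles -/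

section HomologyCover

universe u v

variable {V : Type u} {E : Type v}

open Classical in
/-- The class of the edge `e` in `E → ZMod 2`: the indicator function of `{e, rev e}`. -/
noncomputable def parity (G : WGraph V E) (e : E) : E → ZMod 2 :=
  Pi.single e 1 + Pi.single (G.rev e) 1

theorem parity_rev (G : WGraph V E) (e : E) : G.parity (G.rev e) = G.parity e := by
  rw [parity, parity, G.rev_rev, add_comm]

theorem parity_apply_self (G : WGraph V E) (e : E) : G.parity e e = 1 := by
  simp [parity, (G.rev_ne e).symm]

theorem parity_apply_eq_zero (G : WGraph V E) {e f : E} (h : f ≠ e) (h' : f ≠ G.rev e) :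
    G.parity f e = 0 := by
  have : e ≠ G.rev f := fun h'' => h' (by rw [h'', G.rev_rev])
  simp [parity, h.symm, this]

theorem add_parity_add_parity (G : WGraph V E) (g : E → ZMod 2) (e : E) :
    g + G.parity e + G.parity e = g := by
  funext f
  rw [Pi.add_apply, Pi.add_apply, add_assoc, CharTwo.add_self_eq_zero, add_zero]

/-- The mod 2 homology cover: the second coordinate of a vertex records, for each undirected edge,
the parity of the number of times it was crossed. It need not be connected. -/
noncomputable def parityCover (G : WGraph V E) (hE : Finite E) :
    WGraph (V × (E → ZMod 2)) (E × (E → ZMod 2)) where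
  src y := (G.src y.1, y.2)
  tgt y := (G.tgt y.1, y.2 + G.parity y.1)
  rev y := (G.rev y.1, y.2 + G.parity y.1)
  rev_rev y := Prod.ext (G.rev_rev y.1) (by
    dsimp only; rw [parity_rev, add_parity_add_parity])
  rev_ne y h := G.rev_ne y.1 (congrArg Prod.fst h)
  src_rev y := Prod.ext (G.src_rev y.1) rfl
  locallyFinite _ := Set.toFinite _
  a y := G.a y.1
  a_rev y := G.a_rev y.1
  b x := G.b x.1

/-- The projection of the mod 2 homology cover to `G`, with fibres of cardinality `2 ^ |E|`. -/
noncomputable def parityCovering (G : WGraph V E) (hE : Finite E) :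
    Covering (G.parityCover hE) G where
  onV := Prod.fst
  onE := Prod.fst
  src_onE _ := rfl
  tgt_onE _ := rfl
  rev_onE _ := rfl
  a_onE _ := rfl
  b_onV _ := rfl
  bijOn_src := parityCovering_bijOn
  bijOn_tgt := bijOn_tgt_of_bijOn_src (fun _ => rfl) parityCovering_bijOn
where
  parityCovering_bijOn (x : V × (E → ZMod 2)) : Set.BijOn Prod.fst
      {y | (G.parityCover hE).src y = x} {e | G.src e = x.1} := by
    refine ⟨?_, ?_, fun e he => ⟨(e, x.2), Prod.ext he rfl, rfl⟩⟩
    · rintro y rfl; rfl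
    · rintro y rfl z hz hyz
      exact Prod.ext hyz (congrArg Prod.snd hz).symm

theorem Covering.isNonbacktracking_map {V' E' : Type*} {H : WGraph V' E'} {G : WGraph V E}
    (p : Covering H G) {w : List E'} (hw : H.IsNonbacktracking w) :
    G.IsNonbacktracking (w.map p.onE) := by
  rw [IsNonbacktracking, List.isChain_map]
  refine List.IsChain.imp (fun e f h => ⟨?_, fun h' => h.2 ?_⟩) hw
  · rw [p.tgt_onE, p.src_onE, h.1]
  · rw [p.rev_onE] at h'
    exact (p.bijOn_tgt (H.src f)).injOn h.1 (H.tgt_rev f) h'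

theorem snd_tgt_getLast (G : WGraph V E) (hE : Finite E) (w : List (E × (E → ZMod 2)))
    (hw : w ≠ []) (h : (G.parityCover hE).IsNonbacktracking w) :
    ((G.parityCover hE).tgt (w.getLast hw)).2 =
      ((G.parityCover hE).src (w.head hw)).2 + (w.map fun y => G.parity y.1).sum := by
  induction w with
  | nil => exact absurd rfl hw
  | cons y w ih =>
    cases w with
    | nil => simp [parityCover]
    | cons z w =>
      obtain ⟨⟨hyz, -⟩, h'⟩ := List.isChain_cons_cons.1 h
      rw [List.getLast_cons (by simp), ih (by simp) h']
      have : ((G.parityCover hE).src z).2 = ((G.parityCover hE).src y).2 + G.parity y.1 :=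
        (congrArg Prod.snd hyz).symm
      rw [List.head_cons, List.head_cons, this, List.map_cons (a := y), List.sum_cons, add_assoc]

/-- A closed non-backtracking walk of minimal length crosses its first undirected edge only once,
so it does not lift to a closed walk of the mod 2 homology cover. -/
theorem NoCycleUpTo.parityCover {G : WGraph V E} {n : ℕ} (hG : G.NoCycleUpTo n) (hE : Finite E) :
    (G.parityCover hE).NoCycleUpTo (n + 1) := by
  intro w' hw' hlen hnb hclosed
  have hsum := G.snd_tgt_getLast hE w' hw' hnb
  rw [← hclosed, left_eq_add] at hsum
  have hnbG : G.IsNonbacktracking (w'.map Prod.fst) :=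
    (G.parityCovering hE).isNonbacktracking_map hnb
  obtain ⟨y, t', rfl⟩ := List.exists_cons_of_ne_nil hw'
  obtain ⟨e, g⟩ := y
  -- The coordinate `e` of the total parity vanishes, so the first edge is crossed a second time.
  have key : ∃ f ∈ t'.map Prod.fst, f = e ∨ f = G.rev e := by
    by_contra! hcon
    have h0 := congrFun hsum e
    rw [List.map_cons, List.sum_cons, Pi.add_apply, parity_apply_self] at h0
    have h1 : (t'.map fun y => G.parity y.1).sum e = 0 := by
      refine (map_list_sum (Pi.evalAddMonoidHom (fun _ : E => ZMod 2) e) _).trans ?_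
      rw [List.map_map]
      refine List.sum_eq_zero fun z hz => ?_
      obtain ⟨y, hy, rfl⟩ := List.mem_map.1 hz
      have := hcon y.1 (List.mem_map_of_mem hy)
      exact G.parity_apply_eq_zero this.1 this.2
    rw [h1] at h0
    simp at h0
  obtain ⟨f, hf, hfe⟩ := key
  obtain ⟨s, s', hs⟩ := List.append_of_mem hf
  have hl : s.length + s'.length + 1 ≤ n := by
    have h1 := congrArg List.length hs
    simp only [List.length_map, List.length_append, List.length_cons] at h1 hlen
    omega
  rw [List.map_cons, hs] at hnbG
  have hchain : G.IsNonbacktracking (e :: s) ∧ G.tgt ((e :: s).getLast (by simp)) = G.src f := by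
    have h2 : G.IsNonbacktracking ((e :: s) ++ f :: s') := hnbG
    obtain ⟨ha, -, hb⟩ := List.isChain_append.1 h2
    exact ⟨ha, (hb _ (List.getLast_mem_getLast? _) f rfl).1⟩
  -- The walk between the two crossings gives a closed walk of length at most `n`: with the first
  -- crossing included if both have the same direction, and excluded if they are opposite.
  rcases hfe with rfl | rfl
  · exact hG (f :: s) (by simp) (by simp; omega) hchain.1 hchain.2.symm
  · cases s with
    | nil => exact (List.isChain_cons_cons.1 hnbG).1.2 (G.rev_rev e).symm
    | cons c s =>
      obtain ⟨⟨h1, -⟩, h2⟩ := List.isChain_cons_cons.1 hchain.1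
      refine hG (c :: s) (by simp) (by simp at hl ⊢; omega) h2 ?_
      rw [List.head_cons, ← h1]
      have := hchain.2
      rw [List.getLast_cons (by simp)] at this
      rw [this, G.src_rev]

/-- A finite graph has finite covers, with fibres of constant cardinality `N`, that have no closed
non-backtracking walk of length at most `n`. -/
theorem exists_finite_covering [Fintype V] [Fintype E] (G : WGraph V E) (n : ℕ) :
    ∃ (V' : Type (max u v)) (E' : Type v) (_ : Fintype V') (_ : Fintype E')
      (H : WGraph V' E') (p : Covering H G) (N : ℕ), 0 < N ∧
      (∀ F : V → ℝ, ∑ x, F (p.onV x) = N * ∑ u, F u) ∧ H.NoCycleUpTo n := by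
  classical
  have hsum : ∀ {V : Type (max u v)} {E : Type v} [Fintype V] [Fintype E] (F : V → ℝ),
      ∑ x : V × (E → ZMod 2), F x.1 = (Fintype.card (E → ZMod 2) : ℕ) * ∑ u, F u := by
    intro V E _ _ F
    simp only [Fintype.sum_prod_type, Finset.sum_const, nsmul_eq_mul, Finset.mul_sum,
      Finset.card_univ]
  induction n with
  | zero =>
    refine ⟨V × (E → ZMod 2), E × (E → ZMod 2), inferInstance, inferInstance, _,
      G.parityCovering inferInstance, Fintype.card (E → ZMod 2), Fintype.card_pos, fun F => ?_, ?_⟩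
    · simp only [parityCovering, Fintype.sum_prod_type, Finset.sum_const, nsmul_eq_mul,
        Finset.mul_sum, Finset.card_univ]
    · intro w hw hlen
      exact absurd (List.length_eq_zero_iff.1 (Nat.le_zero.1 hlen)) hw
  | succ n ih =>
    obtain ⟨V', E', _, _, H, p, N, hN, hp, hH⟩ := ih
    refine ⟨V' × (E' → ZMod 2), E' × (E' → ZMod 2), inferInstance, inferInstance, _,
      p.comp (H.parityCovering inferInstance), Fintype.card (E' → ZMod 2) * N,
      Nat.mul_pos Fintype.card_pos hN, fun F => ?_, hH.parityCover inferInstance⟩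
    rw [Nat.cast_mul, mul_assoc, ← hp]
    exact hsum fun x => F (p.onV x)

end HomologyCover

/-! ### Eigenfunctions supported on the components of an induced subgraph -/

section LocalEigenfunctions

variable {V E V' E' : Type*}

/-- A nonzero function supported on the component `C` of the subgraph induced by `X`, satisfying
the eigenvalue equation of `G` at every vertex of `X`. -/
structure IsLocalEigenfunction (G : WGraph V E) (X : Set V) (lam : ℂ) (C : G.Component X)
    (f : V → ℂ) : Prop where
  ne_zero : f ≠ 0
  eq_zero : ∀ v, v ∉ Subtype.val '' C.supp → f v = 0
  jacobi_eq : ∀ v ∈ X, G.jacobi f v = lam * f v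

theorem reachable_src_tgt (G : WGraph V E) (e : E) : G.toSimple.Reachable (G.src e) (G.tgt e) := by
  by_cases h : G.src e = G.tgt e
  · rw [h]
  · exact SimpleGraph.Adj.reachable ⟨h, e, rfl, rfl⟩

theorem src_mem_supp_iff {G : WGraph V E} (C : G.toSimple.ConnectedComponent) (e : E) :
    G.src e ∈ C.supp ↔ G.tgt e ∈ C.supp := by
  rw [SimpleGraph.ConnectedComponent.mem_supp_iff, SimpleGraph.ConnectedComponent.mem_supp_iff,
    SimpleGraph.ConnectedComponent.eq.2 (G.reachable_src_tgt e)]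

theorem src_mem_component_iff {G : WGraph V E} {X : Set V} (C : G.Component X) {e : E}
    (hs : G.src e ∈ X) (ht : G.tgt e ∈ X) :
    G.src e ∈ Subtype.val '' C.supp ↔ G.tgt e ∈ Subtype.val '' C.supp := by
  have := src_mem_supp_iff C ⟨e, hs, ht⟩
  constructor
  · rintro ⟨v, hv, hve⟩
    obtain rfl : v = ⟨G.src e, hs⟩ := Subtype.ext hve
    exact ⟨_, this.1 hv, rfl⟩
  · rintro ⟨v, hv, hve⟩
    obtain rfl : v = ⟨G.tgt e, ht⟩ := Subtype.ext hve
    exact ⟨_, this.2 hv, rfl⟩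

/-- At the vertices of `X`, the Jacobi operator of `G` acts on a function extended by zero from `X`
as the Jacobi operator of the induced subgraph. -/
theorem jacobi_extend (G : WGraph V E) (X : Set V) (η : X → ℂ) (v : X) :
    G.jacobi (Function.extend Subtype.val η 0) v = (G.induce X).jacobi η v := by
  have hinj : Function.Injective (Subtype.val : X → V) := Subtype.val_injective
  rw [jacobi_apply, jacobi_apply, hinj.extend_apply]
  congr 1
  have hsub : ((G.induce X).inEdges v).map (Function.Embedding.subtype _) ⊆ G.inEdges v := by
    intro e he
    obtain ⟨f, hf, rfl⟩ := Finset.mem_map.1 he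
    rw [mem_inEdges] at hf ⊢
    exact congrArg Subtype.val hf
  rw [← Finset.sum_subset hsub, Finset.sum_map]
  · refine Finset.sum_congr rfl fun e _ => ?_
    congr 1
    exact hinj.extend_apply η 0 ((G.induce X).src e)
  · intro e he he'
    rw [mem_inEdges] at he
    have hX : G.src e ∉ X := fun h => he' (Finset.mem_map.2 ⟨⟨e, h, he ▸ v.2⟩,
      (mem_inEdges _ _ _).2 (Subtype.ext he), rfl⟩)
    rw [Function.extend_apply', Pi.zero_apply, mul_zero]
    rintro ⟨a, ha⟩
    exact hX (ha ▸ a.2)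

theorem exists_isLocalEigenfunction (G : WGraph V E) (X : Set V) (lam : ℂ) (C : G.Component X)
    (h : Module.End.HasEigenvalue ((G.induce X).induce C.supp).jacobi lam) :
    ∃ f, G.IsLocalEigenfunction X lam C f := by
  obtain ⟨η, hη⟩ := h.exists_hasEigenvector
  set ζ : X → ℂ := Function.extend Subtype.val η 0
  have hζ : ∀ v : C.supp, ζ v = η v := Subtype.val_injective.extend_apply η 0
  have hζ0 : ∀ v, v ∉ C.supp → ζ v = 0 := fun v hv =>
    Function.extend_apply' _ _ _ (by rintro ⟨a, rfl⟩; exact hv a.2)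
  refine ⟨Function.extend Subtype.val ζ 0, fun h0 => hη.2 ?_, fun v hv => ?_, fun v hv => ?_⟩
  · funext v
    have := congrFun h0 v.1.1
    rwa [Subtype.val_injective.extend_apply, hζ] at this
  · by_cases hvX : v ∈ X
    · lift v to X using hvX
      rw [Subtype.val_injective.extend_apply]
      exact hζ0 v fun h => hv ⟨v, h, rfl⟩
    · exact Function.extend_apply' _ _ _ (by rintro ⟨a, rfl⟩; exact hvX a.2)
  · lift v to X using hv
    rw [jacobi_extend, Subtype.val_injective.extend_apply]
    by_cases hvC : v ∈ C.supp
    · lift v to C.supp using hvC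
      rw [jacobi_extend, hζ, hη.apply_eq_smul, Pi.smul_apply, smul_eq_mul]
    · rw [hζ0 v hvC, mul_zero]
      refine ((G.induce X).jacobi_congr (ζ := 0) (hζ0 v hvC) fun e he => hζ0 _ ?_).trans ?_
      · rw [src_mem_supp_iff, he]; exact hvC
      · rw [map_zero]; rfl

theorem IsLocalEigenfunction.jacobi_eq_of_notMem_boundary {G : WGraph V E} {X : Set V} {lam : ℂ}
    {C : G.Component X} {f : V → ℂ} (hf : G.IsLocalEigenfunction X lam C f) {v : V}
    (hv : v ∉ G.boundary X) : G.jacobi f v = lam * f v := by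
  by_cases hX : v ∈ X
  · exact hf.jacobi_eq v hX
  have hf0 : ∀ u, u ∉ X → f u = 0 := fun u hu =>
    hf.eq_zero u (by rintro ⟨a, -, rfl⟩; exact hu a.2)
  rw [hf0 v hX, mul_zero]
  refine (G.jacobi_congr (ζ := 0) (hf0 v hX) fun e he => hf0 _ fun h => hv ⟨hX, e, h, he⟩).trans ?_
  rw [map_zero]; rfl

/-- Eigenfunctions on the components of the subgraph induced by `X` span a space of dimension
`cc X`, and `|∂X|` linear conditions single out those of its elements that are eigenfunctions
of `G`. -/
theorem cc_sub_boundary_le_finrank [Finite V] (G : WGraph V E) (X : Set V) (lam : ℂ)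
    (h : ∀ C : G.Component X, ∃ f, G.IsLocalEigenfunction X lam C f) :
    (G.cc X : ℤ) - (G.boundary X).ncard ≤
      Module.finrank ℂ (Module.End.eigenspace G.jacobi lam) := by
  classical
  have : Fintype V := Fintype.ofFinite V
  have hfin : Finite (G.Component X) := Quot.finite _
  have : Fintype (G.Component X) := Fintype.ofFinite _
  choose f hf using h
  have hpt : ∀ C, ∃ v ∈ Subtype.val '' C.supp, f C v ≠ 0 := by
    intro C
    obtain ⟨v, hv⟩ := Function.ne_iff.1 (hf C).ne_zero
    exact ⟨v, by by_contra h; exact hv ((hf C).eq_zero v h), hv⟩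
  choose x hx hfx using hpt
  have hoff : ∀ C D, C ≠ D → f C (x D) = 0 := by
    intro C D hCD
    refine (hf C).eq_zero _ fun hC => hCD ?_
    obtain ⟨a, ha, hax⟩ := hC
    obtain ⟨b, hb, hbx⟩ := hx D
    obtain rfl : a = b := Subtype.ext (hax.trans hbx.symm)
    exact ha.symm.trans hb
  have hli : LinearIndependent ℂ f := by
    rw [Fintype.linearIndependent_iff]
    intro g hg D
    have := congrFun hg (x D)
    rw [Finset.sum_apply, Finset.sum_eq_single D] at this
    · simpa [hfx D] using this
    · intro C _ hCD
      simp [hoff C D hCD]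
    · simp
  have hS := finrank_span_eq_card hli
  set S := Submodule.span ℂ (Set.range f)
  set A : Module.End ℂ (V → ℂ) := G.jacobi - algebraMap ℂ _ lam
  -- On `S` the function `A s` is supported on the boundary, so the kernel of `L` consists of
  -- eigenfunctions.
  let L : S →ₗ[ℂ] (G.boundary X → ℂ) :=
    (LinearMap.funLeft ℂ ℂ Subtype.val).comp (A.domRestrict S)
  have hA : ∀ s ∈ S, ∀ v ∉ G.boundary X, A s v = 0 := by
    intro s hs v hv
    induction hs using Submodule.span_induction with
    | mem s hs =>
      obtain ⟨C, rfl⟩ := hs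
      change G.jacobi (f C) v - lam * f C v = 0
      rw [(hf C).jacobi_eq_of_notMem_boundary hv, sub_self]
    | zero => simp
    | add s t _ _ hs ht => rw [map_add, Pi.add_apply, hs, ht, add_zero]
    | smul c s _ hs => rw [map_smul, Pi.smul_apply, hs, smul_zero]
  have hker : Module.finrank ℂ (LinearMap.ker L) ≤
      Module.finrank ℂ (Module.End.eigenspace G.jacobi lam) := by
    have hmem : ∀ s : LinearMap.ker L, (s.1.1 : V → ℂ) ∈ Module.End.eigenspace G.jacobi lam := by
      rintro ⟨s, hs⟩
      rw [Module.End.mem_eigenspace_iff]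
      refine sub_eq_zero.1 (funext fun v => ?_ : A s.1 = 0)
      by_cases hv : v ∈ G.boundary X
      · exact congrFun hs ⟨v, hv⟩
      · exact hA s.1 s.2 v hv
    refine LinearMap.finrank_le_finrank_of_injective
      (f := (S.subtype.comp (LinearMap.ker L).subtype).codRestrict _ hmem) ?_
    intro s t hst
    have hst' := congrArg Subtype.val hst
    exact Subtype.ext (Subtype.ext hst')
  have hrange : Module.finrank ℂ (LinearMap.range L) ≤ (G.boundary X).ncard := by
    refine (Submodule.finrank_le _).trans ?_
    rw [Module.finrank_fintype_fun_eq_card, ← Nat.card_eq_fintype_card, Nat.card_coe_set_eq]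
  have hrn := LinearMap.finrank_range_add_finrank_ker L
  have hcc : G.cc X = Fintype.card (G.Component X) := Nat.card_eq_fintype_card
  omega

/-! ### The preimage of `X` in a finite cover -/

section Preimage

variable {H : WGraph V' E'} {G : WGraph V E} (p : Covering H G)

theorem Covering.reachable_map {v w : V'} (h : H.toSimple.Reachable v w) :
    G.toSimple.Reachable (p.onV v) (p.onV w) := by
  obtain ⟨w⟩ := h
  induction w with
  | nil => exact SimpleGraph.Reachable.refl _
  | cons hadj _ ih =>
    obtain ⟨-, e, rfl, rfl⟩ := hadj
    rw [← p.tgt_onE] at ih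
    rw [← p.src_onE]
    exact (G.reachable_src_tgt _).trans ih

theorem Covering.exists_reachable_lift {v : V'} {u : V} (h : G.toSimple.Reachable (p.onV v) u) :
    ∃ w, H.toSimple.Reachable v w ∧ p.onV w = u := by
  obtain ⟨w⟩ := h
  suffices h : ∀ {x y : V} (_ : G.toSimple.Walk x y) (v : V'), p.onV v = x →
      ∃ w, H.toSimple.Reachable v w ∧ p.onV w = y from h w v rfl
  intro x y w
  induction w with
  | nil => exact fun v hv => ⟨v, SimpleGraph.Reachable.refl _, hv⟩
  | cons hadj _ ih =>
    intro v hv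
    obtain ⟨-, e, he, he'⟩ := hadj
    obtain ⟨f, rfl, rfl⟩ := (p.bijOn_src v).surjOn (show G.src e = p.onV v by rw [he, hv])
    obtain ⟨w, hw, hw'⟩ := ih (H.tgt f) (by rw [← p.tgt_onE, he'])
    exact ⟨w, (H.reachable_src_tgt f).trans hw, hw'⟩

/-- Over an acyclic graph, a connected component of a covering meets each fibre at most once. -/
theorem Covering.eq_of_reachable (hG : G.Acyclic) {v w : V'} (h : H.toSimple.Reachable v w)
    (hvw : p.onV v = p.onV w) : v = w := by
  obtain ⟨l, hl, rfl⟩ := H.exists_isWalkFrom h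
  have h0 : l.map p.onE = [] := (hG.noCycleUpTo _).eq_nil (p.isWalkFrom_map hl) le_rfl
    (by rw [p.endpt_map, ← hvw])
  rw [List.map_eq_nil_iff.1 h0]
  rfl

theorem Covering.boundary_preimage (X : Set V) :
    H.boundary (p.onV ⁻¹' X) = p.onV ⁻¹' G.boundary X := by
  ext v
  constructor
  · rintro ⟨hv, e, he, rfl⟩
    exact ⟨hv, p.onE e, by rw [p.src_onE]; exact he, p.tgt_onE e⟩
  · rintro ⟨hv, e, he, he'⟩
    obtain ⟨f, hf, rfl⟩ := (p.bijOn_tgt v).surjOn he'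
    exact ⟨hv, f, by rw [Set.mem_preimage, ← p.src_onE]; exact he, hf⟩

/-- The pull-back of a local eigenfunction, cut off outside one component of the preimage. -/
theorem Covering.exists_isLocalEigenfunction_preimage {X : Set V} {lam : ℂ}
    (h : ∀ C : G.Component X, ∃ f, G.IsLocalEigenfunction X lam C f)
    (D : H.Component (p.onV ⁻¹' X)) : ∃ f, H.IsLocalEigenfunction (p.onV ⁻¹' X) lam D f := by
  classical
  obtain ⟨y, hy⟩ := D.exists_rep
  obtain ⟨η, hη⟩ := h ((G.induce X).toSimple.connectedComponentMk ((p.induce X).onV y))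
  have hη0 : ∀ u, u ∉ X → η u = 0 := fun u hu =>
    hη.eq_zero u (by rintro ⟨a, -, rfl⟩; exact hu a.2)
  have hDX : ∀ x ∈ Subtype.val '' D.supp, p.onV x ∈ X := by
    rintro _ ⟨a, -, rfl⟩; exact a.2
  refine ⟨(Subtype.val '' D.supp).indicator (η ∘ p.onV), fun h0 => ?_,
    fun v hv => Set.indicator_of_notMem hv _, fun v hv => ?_⟩
  · obtain ⟨u, hu⟩ := Function.ne_iff.1 hη.ne_zero
    have huC := by_contra fun h => hu (hη.eq_zero u h)
    obtain ⟨u, huC, rfl⟩ := huC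
    obtain ⟨x, hx, rfl⟩ := (p.induce X).exists_reachable_lift
      (SimpleGraph.ConnectedComponent.exact huC).symm
    have hxD : x.1 ∈ Subtype.val '' D.supp :=
      ⟨x, (SimpleGraph.ConnectedComponent.sound hx.symm).trans hy, rfl⟩
    have := congrFun h0 x.1
    rw [Set.indicator_of_mem hxD] at this
    exact hu this
  · by_cases hvD : v ∈ Subtype.val '' D.supp
    · rw [Set.indicator_of_mem hvD]
      refine (H.jacobi_congr (ζ := η ∘ p.onV) (Set.indicator_of_mem hvD _) fun e he => ?_).trans ?_
      · by_cases hs : H.src e ∈ p.onV ⁻¹' X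
        · refine Set.indicator_of_mem ((src_mem_component_iff D hs ?_).2 ?_) _
          · rw [he]; exact hv
          · rw [he]; exact hvD
        · rw [Set.indicator_of_notMem fun h => hs (hDX _ h)]
          exact (hη0 _ hs).symm
      · rw [p.jacobi_comp]
        exact hη.jacobi_eq _ hv
    · rw [Set.indicator_of_notMem hvD, mul_zero]
      refine (H.jacobi_congr (ζ := 0) (Set.indicator_of_notMem hvD _) fun e he => ?_).trans ?_
      · refine Set.indicator_of_notMem (fun h => hvD ?_) _
        rw [← he]
        exact (src_mem_component_iff D (hDX _ h) (by rw [he]; exact hv)).1 h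
      · rw [map_zero]; rfl

variable [Fintype V] [Fintype V'] {N : ℕ}

theorem Covering.ncard_preimage (hN : ∀ F : V → ℝ, ∑ x, F (p.onV x) = N * ∑ u, F u) (S : Set V) :
    (p.onV ⁻¹' S).ncard = N * S.ncard := by
  classical
  have := hN (S.indicator 1)
  have h₁ : ∀ x, S.indicator (1 : V → ℝ) (p.onV x) = (p.onV ⁻¹' S).indicator 1 x := fun x => rfl
  simp only [h₁, Set.indicator_apply, Pi.one_apply, Finset.sum_boole] at this
  rw [Set.ncard_eq_toFinset_card', Set.ncard_eq_toFinset_card', ← Set.filter_mem_univ_eq_toFinset,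
    ← Set.filter_mem_univ_eq_toFinset]
  exact_mod_cast this

/-- Each component of an acyclic induced subgraph lifts to at least `N` components: the points of
the fibre over one of its vertices lie in distinct ones. -/
theorem Covering.mul_cc_le_cc_preimage
    (hN : ∀ F : V → ℝ, ∑ x, F (p.onV x) = N * ∑ u, F u) {X : Set V} (hX : (G.induce X).Acyclic) :
    N * G.cc X ≤ H.cc (p.onV ⁻¹' X) := by
  classical
  have hfin : Finite (H.Component (p.onV ⁻¹' X)) := Quot.finite _
  let r : G.Component X → V := fun C => (Quot.out C).1
  have hr : ∀ C, (G.induce X).toSimple.connectedComponentMk (Quot.out C) = C := Quot.out_eq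
  have hrinj : Function.Injective r := fun C D h => by
    rw [← hr C, ← hr D, Subtype.ext h]
  -- The points over the chosen representatives of the components are mapped to their components.
  have hcard : (p.onV ⁻¹' Set.range r).ncard = N * G.cc X := by
    rw [p.ncard_preimage hN, ← Nat.card_coe_set_eq, Nat.card_range_of_injective hrinj, cc]
  rw [← hcard, ← Nat.card_coe_set_eq]
  have hmem : ∀ x : p.onV ⁻¹' Set.range r, x.1 ∈ p.onV ⁻¹' X := by
    rintro ⟨x, C, hC⟩
    rw [Set.mem_preimage, ← hC]
    exact (Quot.out C).2
  refine Nat.card_le_card_of_injective (fun x : p.onV ⁻¹' Set.range r =>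
    (H.induce (p.onV ⁻¹' X)).toSimple.connectedComponentMk ⟨x.1, hmem x⟩) fun x y hxy => ?_
  have hreach := SimpleGraph.ConnectedComponent.exact hxy
  have hreach' := SimpleGraph.ConnectedComponent.sound ((p.induce X).reachable_map hreach)
  obtain ⟨C, hC⟩ := x.2
  obtain ⟨D, hD⟩ := y.2
  have hC' : (p.induce X).onV ⟨x.1, hmem x⟩ = Quot.out C := Subtype.ext hC.symm
  have hD' : (p.induce X).onV ⟨y.1, hmem y⟩ = Quot.out D := Subtype.ext hD.symm
  have hCD : C = D := by
    rw [← hr C, ← hr D, ← hC', ← hD']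
    exact hreach'
  have h := congrArg Subtype.val
    ((p.induce X).eq_of_reachable hX hreach (by rw [hC', hD', hCD]))
  exact Subtype.ext h

/-- The eigenspace of a finite cover grows in proportion to its degree. -/
theorem Covering.mul_cc_sub_boundary_le_finrank
    (hN : ∀ F : V → ℝ, ∑ x, F (p.onV x) = N * ∑ u, F u) {X : Set V} (hX : (G.induce X).Acyclic)
    {lam : ℂ} (h : ∀ C : G.Component X, ∃ f, G.IsLocalEigenfunction X lam C f) :
    (N : ℝ) * ((G.cc X : ℝ) - (G.boundary X).ncard) ≤
      Module.finrank ℂ (Module.End.eigenspace H.jacobi lam) := by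
  have h₁ := H.cc_sub_boundary_le_finrank _ lam (p.exists_isLocalEigenfunction_preimage h)
  rw [p.boundary_preimage, p.ncard_preimage hN] at h₁
  have h₂ := p.mul_cc_le_cc_preimage hN hX
  have h₁' : ((H.cc (p.onV ⁻¹' X) : ℝ)) - (N * (G.boundary X).ncard : ℕ) ≤
    Module.finrank ℂ (Module.End.eigenspace H.jacobi lam) := by exact_mod_cast h₁
  have h₂' : ((N * G.cc X : ℕ) : ℝ) ≤ H.cc (p.onV ⁻¹' X) := by exact_mod_cast h₂
  push_cast at h₁' h₂'
  linarith

end Preimage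

end LocalEigenfunctions

end WGraph

/-! ### Eigenvectors and spectral measures -/

section SpectralMeasure

open Filter Topology

variable {H : Type*} [NormedAddCommGroup H] [InnerProductSpace ℂ H]

/-- `f(A)` acts as multiplication by `f lam` on eigenvectors: this holds for polynomials, and it
is a closed condition on `f`. -/
theorem cfc_apply_of_apply_eq_smul [CompleteSpace H] {A : H →L[ℂ] H} (hA : IsSelfAdjoint A)
    {lam : ℝ} {y : H} (hy : A y = (lam : ℂ) • y) {f : ℝ → ℝ} (hf : Continuous f) :
    cfc f A y = (f lam : ℂ) • y := by
  by_cases hy0 : y = 0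
  · simp [hy0]
  have hlam : lam ∈ spectrum ℝ A := by
    rw [spectrum.mem_iff]
    rintro ⟨u, hu⟩
    apply hy0
    have h1 : (u : H →L[ℂ] H) y = 0 := by
      rw [hu, sub_apply, hy, ContinuousLinearMap.algebraMap_apply]
      simp
    calc y = ((u⁻¹ : (H →L[ℂ] H)ˣ) * u : H →L[ℂ] H) y := by rw [Units.inv_mul]; rfl
      _ = 0 := by rw [mul_apply_eq_comp, h1, map_zero]
  rw [cfc_apply f A hA hf.continuousOn]
  suffices h : ∀ g : C(spectrum ℝ A, ℝ), cfcHom hA g y = (g ⟨lam, hlam⟩ : ℂ) • y from h _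
  intro g
  induction g using ContinuousMap.induction_on_of_compact with
  | const r =>
    have : (ContinuousMap.const (spectrum ℝ A) r) = algebraMap ℝ _ r := rfl
    rw [this, AlgHomClass.commutes]
    simp [ContinuousLinearMap.algebraMap_apply]
  | id => rw [cfcHom_id, hy]; rfl
  | star_id => rw [star_trivial, cfcHom_id, hy]; rfl
  | add f g hf hg => rw [map_add, add_apply, hf, hg, ← add_smul]; simp
  | mul f g hf hg =>
    rw [map_mul, mul_apply_eq_comp, hg, map_smul, hf, smul_smul]
    simp [mul_comm]
  | frequently f h =>
    have hc : Continuous fun g : C(spectrum ℝ A, ℝ) => cfcHom hA g y :=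
      (ContinuousLinearMap.apply ℂ H y).continuous.comp (cfcHom_continuous hA)
    have hc' : Continuous fun g : C(spectrum ℝ A, ℝ) => (g ⟨lam, hlam⟩ : ℂ) • y :=
      (Complex.continuous_ofReal.comp (continuous_eval_const _)).smul continuous_const
    exact h.mem_of_closed (isClosed_eq hc hc')

/-- If `y` is a `lam`-eigenvector or zero, and `x - y` is orthogonal to it, the spectral measure
at `x` has an atom of mass at least `‖y‖ ^ 2` at `lam`. -/
theorem ofReal_norm_sq_le_spectralMeasure [CompleteSpace H] {A : H →L[ℂ] H}
    (hA : IsSelfAdjoint A) {lam : ℝ} {x y : H} (hy : A y = (lam : ℂ) • y)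
    (hxy : inner ℂ y (x - y) = 0) :
    ENNReal.ofReal (‖y‖ ^ 2) ≤ spectralMeasure A hA x {lam} := by
  have hreg : (spectralMeasure A hA x).Regular := RealRMK.regular_rieszMeasure _
  rw [Set.measure_eq_iInf_isOpen]
  refine le_iInf₂ fun U hlU => le_iInf fun hU => ?_
  obtain ⟨f₀, hf1, hf2, hf3⟩ := exists_continuousMap_one_of_isCompact_subset_isOpen
    (isCompact_singleton (x := lam)) hU hlU
  let f : C_c(ℝ, ℝ) := ⟨f₀, hasCompactSupport_def.mpr hf2⟩
  have hf : ∀ t, 0 ≤ f t ∧ f t ≤ 1 := fun t => ⟨(hf3.2 t).1, (hf3.2 t).2⟩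
  refine le_trans ?_ (RealRMK.le_rieszMeasure_tsupport_subset (spectralFunctional A x) hf hf3.1)
  refine ENNReal.ofReal_le_ofReal ?_
  change ‖y‖ ^ 2 ≤ RCLike.re (inner ℂ x (cfc (f : ℝ → ℝ) A x))
  have hfA : 0 ≤ cfc (f : ℝ → ℝ) A := cfc_nonneg fun t _ => (hf t).1
  have hfy : cfc (f : ℝ → ℝ) A y = y := by
    rw [cfc_apply_of_apply_eq_smul hA hy (f := f) f.continuous]
    have : f lam = 1 := hf1 rfl
    rw [this]; simp
  obtain ⟨z, rfl⟩ : ∃ z, x = y + z := ⟨x - y, by abel⟩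
  rw [add_sub_cancel_left] at hxy
  have hpos := ((ContinuousLinearMap.nonneg_iff_isPositive _).1 hfA).re_inner_nonneg_right z
  have hsa : inner ℂ y (cfc (f : ℝ → ℝ) A z) = inner ℂ y z := by
    have := ((ContinuousLinearMap.nonneg_iff_isPositive _).1 hfA).isSelfAdjoint.isSymmetric y z
    rw [ContinuousLinearMap.coe_coe, hfy] at this
    exact this.symm
  have hzy : inner ℂ z y = 0 := by rw [← inner_conj_symm, hxy, map_zero]
  rw [map_add, hfy, inner_add_left, inner_add_right, inner_add_right, hsa, hxy, hzy]
  simp only [add_zero, zero_add, map_add]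
  rw [inner_self_eq_norm_sq]
  linarith

/-- The operator `1 - B² / M²`: a contraction when `‖B x‖ ≤ M ‖x‖` for all `x`, whose powers single
out the kernel of `B`. -/
noncomputable def kernelFilter (B : H →L[ℂ] H) (M : ℝ) : H →L[ℂ] H :=
  1 - ((M ^ 2 : ℝ) : ℂ)⁻¹ • (B * B)

theorem kernelFilter_pow_apply_of_mem_ker {B : H →L[ℂ] H} {z : H} (hz : B z = 0) (M : ℝ) (m : ℕ) :
    (kernelFilter B M ^ m) z = z := by
  have h : kernelFilter B M z = z := by simp [kernelFilter, hz]
  induction m with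
  | zero => rfl
  | succ m ih => rw [pow_succ, mul_apply_eq_comp, h, ih]

variable [CompleteSpace H]

theorem isSelfAdjoint_kernelFilter {B : H →L[ℂ] H} (hB : IsSelfAdjoint B) (M : ℝ) :
    IsSelfAdjoint (kernelFilter B M) := by
  refine (IsSelfAdjoint.one _).sub (IsSelfAdjoint.smul ?_ ?_)
  · rw [← Complex.ofReal_inv]; exact Complex.conj_ofReal _
  · simpa [pow_two] using hB.pow 2

theorem norm_kernelFilter_sq_le {B : H →L[ℂ] H} (hB : IsSelfAdjoint B) {M : ℝ} (hM : 0 < M)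
    (h : ∀ x, ‖B x‖ ≤ M * ‖x‖) (x : H) :
    ‖kernelFilter B M x‖ ^ 2 ≤ ‖x‖ ^ 2 - (M ^ 2)⁻¹ * ‖B x‖ ^ 2 := by
  have hBx : inner ℂ x (B (B x)) = inner ℂ (B x) (B x) := (hB.isSymmetric x (B x)).symm
  have e : kernelFilter B M x = x - ((M ^ 2 : ℝ) : ℂ)⁻¹ • B (B x) := rfl
  rw [e, @norm_sub_sq ℂ, inner_smul_right, hBx, norm_smul, inner_self_eq_norm_sq_to_K]
  have h1 : ‖(((M ^ 2 : ℝ) : ℂ))⁻¹‖ = (M ^ 2)⁻¹ := by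
    rw [norm_inv, Complex.norm_real, Real.norm_of_nonneg (by positivity)]
  have h2 : RCLike.re ((((M ^ 2 : ℝ) : ℂ))⁻¹ * ((‖B x‖ : ℂ)) ^ 2) = (M ^ 2)⁻¹ * ‖B x‖ ^ 2 := by
    rw [← Complex.ofReal_inv, ← Complex.ofReal_pow, ← Complex.ofReal_mul]
    exact Complex.ofReal_re _
  have h3 : ‖B (B x)‖ ^ 2 ≤ M ^ 2 * ‖B x‖ ^ 2 := by
    rw [← mul_pow]; gcongr; exact h _
  have h4 : ((M ^ 2)⁻¹ * ‖B (B x)‖) ^ 2 ≤ (M ^ 2)⁻¹ * ‖B x‖ ^ 2 := by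
    calc ((M ^ 2)⁻¹ * ‖B (B x)‖) ^ 2 = (M ^ 2)⁻¹ * ((M ^ 2)⁻¹ * ‖B (B x)‖ ^ 2) := by ring
      _ ≤ (M ^ 2)⁻¹ * ((M ^ 2)⁻¹ * (M ^ 2 * ‖B x‖ ^ 2)) := by gcongr
      _ = _ := by field_simp
  rw [h1]
  have h5 := h2
  simp only [Complex.coe_algebraMap] at h5 ⊢
  rw [h5]
  linarith

theorem inner_pow_pow {R : H →L[ℂ] H} (hR : IsSelfAdjoint R) (m k : ℕ) (x y : H) :
    inner ℂ ((R ^ m) x) ((R ^ k) y) = inner ℂ x ((R ^ (m + k)) y) := by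
  rw [pow_add, mul_apply_eq_comp]
  exact (hR.pow m).isSymmetric x _

/-- The powers of `1 - B² / M²` applied to `x` converge to the orthogonal projection `y` of `x` to
the kernel of `B`; only the convergence of the squared norms is recorded. -/
theorem exists_ker_tendsto_norm_kernelFilter {B : H →L[ℂ] H} (hB : IsSelfAdjoint B) {M : ℝ}
    (hM : 0 < M) (h : ∀ x, ‖B x‖ ≤ M * ‖x‖) (x : H) :
    ∃ y, B y = 0 ∧ inner ℂ y (x - y) = 0 ∧
      Tendsto (fun m => ‖(kernelFilter B M ^ m) x‖ ^ 2) atTop (𝓝 (‖y‖ ^ 2)) := by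
  set R := kernelFilter B M
  have hR : IsSelfAdjoint R := isSelfAdjoint_kernelFilter hB M
  have hle : ∀ z, ‖R z‖ ^ 2 ≤ ‖z‖ ^ 2 - (M ^ 2)⁻¹ * ‖B z‖ ^ 2 := norm_kernelFilter_sq_le hB hM h
  have hle' : ∀ z, ‖R z‖ ^ 2 ≤ ‖z‖ ^ 2 := fun z =>
    (hle z).trans (sub_le_self _ (by positivity))
  set c : ℕ → ℝ := fun m => ‖(R ^ m) x‖ ^ 2 with hc
  have hanti : Antitone c := antitone_nat_of_succ_le fun m => by
    have := hle' ((R ^ m) x)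
    rwa [← mul_apply_eq_comp, ← pow_succ'] at this
  have hbdd : BddBelow (Set.range c) := ⟨0, by rintro _ ⟨m, rfl⟩; exact sq_nonneg _⟩
  have hlim := tendsto_atTop_ciInf hanti hbdd
  set L := ⨅ m, c m
  have hL : ∀ m, L ≤ c m := fun m => ciInf_le hbdd m
  -- By self-adjointness `⟪R ^ (2 * m) x, R ^ (2 * k) x⟫ = ‖R ^ (m + k) x‖ ^ 2`, so convergence of the
  -- decreasing sequence of squared norms makes the even powers a Cauchy sequence.
  have hdist : ∀ m k, m ≤ k →
      dist ((R ^ (2 * m)) x) ((R ^ (2 * k)) x) ≤ √(2 * (c (2 * m) - L)) := by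
    intro m k hmk
    rw [dist_eq_norm]
    refine Real.le_sqrt_of_sq_le ?_
    have hcross : RCLike.re (inner ℂ ((R ^ (2 * m)) x) ((R ^ (2 * k)) x)) = c (m + k) := by
      change _ = ‖(R ^ (m + k)) x‖ ^ 2
      rw [inner_pow_pow hR, ← inner_self_eq_norm_sq (𝕜 := ℂ), inner_pow_pow hR]
      congr 4
      ring
    rw [@norm_sub_sq ℂ, hcross]
    have h1 := hL (m + k)
    have h2 : c (2 * k) ≤ c (2 * m) := hanti (by omega)
    change c (2 * m) - 2 * c (m + k) + c (2 * k) ≤ _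
    linarith
  have h2 : Tendsto (fun m : ℕ => 2 * m) atTop atTop :=
    tendsto_id.const_mul_atTop' (by norm_num)
  have hb : Tendsto (fun m => √(2 * (c (2 * m) - L))) atTop (𝓝 0) := by
    have := (((hlim.comp h2).sub_const L).const_mul 2).sqrt
    simpa using this
  obtain ⟨y, hy⟩ := cauchySeq_tendsto_of_complete (cauchySeq_of_le_tendsto_0' _ hdist hb)
  have hRRy : R (R y) = y := by
    have h3 : Tendsto (fun m => R (R ((R ^ (2 * m)) x))) atTop (𝓝 (R (R y))) :=
      ((R.continuous.comp R.continuous).tendsto y).comp hy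
    refine tendsto_nhds_unique h3 ((hy.comp (tendsto_add_atTop_nat 1)).congr fun m => ?_)
    rw [Function.comp_apply, mul_add, mul_one, add_comm, pow_add, pow_two]
    rfl
  have hBy : B y = 0 := by
    have h4 := hle' (R y)
    rw [hRRy] at h4
    have h5 := hle y
    have h6 : (M ^ 2)⁻¹ * ‖B y‖ ^ 2 ≤ 0 := by linarith
    have h7 : ‖B y‖ ^ 2 ≤ 0 := nonpos_of_mul_nonpos_right h6 (by positivity)
    exact norm_eq_zero.1 (pow_eq_zero_iff two_ne_zero |>.1 (le_antisymm h7 (sq_nonneg _)))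
  refine ⟨y, hBy, ?_, ?_⟩
  · rw [inner_sub_right, sub_eq_zero]
    have h8 : Tendsto (fun m => inner ℂ y ((R ^ (2 * m)) x)) atTop (𝓝 (inner ℂ y y)) :=
      tendsto_const_nhds.inner hy
    refine tendsto_nhds_unique (tendsto_const_nhds.congr fun m => ?_) h8
    have := (hR.pow (2 * m)).isSymmetric y x
    rw [ContinuousLinearMap.coe_coe, kernelFilter_pow_apply_of_mem_ker hBy] at this
    exact this
  · have h9 : L = ‖y‖ ^ 2 :=
      tendsto_nhds_unique (hlim.comp h2) ((hy.norm).pow 2)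
    rw [← h9]
    exact hlim

end SpectralMeasure

namespace WGraph

/-! ### From finite covers to the universal cover -/

section UniversalCover

open Polynomial

variable {V E V' E' : Type*}

theorem coe_aeval_jacobiOp (G : WGraph V E) (hG : G.IsBounded) (q : ℂ[X]) (η : ℓ²(V, ℂ)) :
    ⇑(aeval (G.jacobiOp hG) q η) = aeval G.jacobi q (η : V → ℂ) := by
  have hpow : ∀ k, ⇑((G.jacobiOp hG ^ k) η) = (G.jacobi ^ k) (η : V → ℂ) := by
    intro k
    induction k with
    | zero => rfl
    | succ k ih =>
      rw [pow_succ', pow_succ', mul_apply_eq_comp, coe_jacobiOp, ih]; rfl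
  induction q using Polynomial.induction_on' with
  | add p q hp hq => rw [map_add, map_add, add_apply, lp.coeFn_add, hp, hq]; rfl
  | monomial n a =>
    rw [aeval_monomial, aeval_monomial, ← Algebra.smul_def, ← Algebra.smul_def, smul_apply,
      lp.coeFn_smul, hpow]
    rfl

/-- The polynomial `1 - (t - lam)² / M²`. -/
noncomputable def filterPoly (lam M : ℝ) : ℂ[X] :=
  1 - C ((M ^ 2 : ℝ) : ℂ)⁻¹ * ((X - C (lam : ℂ)) * (X - C (lam : ℂ)))

theorem natDegree_filterPoly_pow_le (lam M : ℝ) (k : ℕ) :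
    (filterPoly lam M ^ k).natDegree ≤ k * 2 := by
  refine natDegree_pow_le_of_le k ?_
  unfold filterPoly
  compute_degree

theorem aeval_filterPoly_pow {H : Type*} [NormedAddCommGroup H] [InnerProductSpace ℂ H]
    (A : H →L[ℂ] H) (lam M : ℝ) (k : ℕ) :
    aeval A (filterPoly lam M ^ k) = kernelFilter (A - algebraMap ℂ _ (lam : ℂ)) M ^ k := by
  rw [map_pow]
  congr 1
  simp only [filterPoly, kernelFilter, map_sub, map_one, map_mul, aeval_C, aeval_X]
  rw [Algebra.smul_def]

open Classical in
/-- The squared norm of `(1 - (A - lam)² / M²) ^ m δ` at the root of the tree of non-backtracking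
walks from `u`, written as a diagonal entry of a polynomial in the Jacobi operator. -/
noncomputable def filterMoment (G : WGraph V E) (lam M : ℝ) (m : ℕ) (u : V) : ℝ :=
  (aeval (G.walkTree u).jacobi (filterPoly lam M ^ (m + m)) (Pi.single ⟨[], trivial⟩ 1)
    ⟨[], trivial⟩ : ℂ).re

theorem Covering.norm_kernelFilter_delta_sq {H : WGraph V' E'} {G : WGraph V E}
    (p : Covering H G) (hb : H.IsBounded) (lam M : ℝ) (m : ℕ)
    (hH : H.NoCycleUpTo ((m + m) * 2)) (x : V') :
    ‖(kernelFilter (H.jacobiOp hb - algebraMap ℂ _ (lam : ℂ)) M ^ m) (delta x)‖ ^ 2 =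
      G.filterMoment lam M m (p.onV x) := by
  classical
  have hdelta : ((delta x : ℓ²(V', ℂ)) : V' → ℂ) = Pi.single x 1 := by
    funext y
    simp [delta, lp.single_apply, Pi.single_apply]
  have hsa : IsSelfAdjoint (H.jacobiOp hb - algebraMap ℂ _ (lam : ℂ)) :=
    (H.isSelfAdjoint_jacobiOp hb).sub (IsSelfAdjoint.algebraMap _ (Complex.conj_ofReal lam))
  rw [← inner_self_eq_norm_sq (𝕜 := ℂ), inner_pow_pow (isSelfAdjoint_kernelFilter hsa M),
    inner_delta, ← aeval_filterPoly_pow, coe_aeval_jacobiOp, hdelta, filterMoment]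
  have hdeg := Nat.lt_succ_of_le (natDegree_filterPoly_pow_le lam M (m + m))
  rw [aeval_eq_sum_range' hdeg, aeval_eq_sum_range' hdeg, LinearMap.sum_apply,
    LinearMap.sum_apply, Finset.sum_apply, Finset.sum_apply]
  refine congrArg Complex.re (Finset.sum_congr rfl fun k hk => ?_)
  have hk' : H.NoCycleUpTo k := fun w hw hwk =>
    hH w hw (hwk.trans (Nat.lt_succ_iff.1 (Finset.mem_range.1 hk)))
  rw [LinearMap.smul_apply, LinearMap.smul_apply, Pi.smul_apply, Pi.smul_apply,
    p.jacobi_pow_single hk']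

/-- On a finite graph, the trace of a power of `(1 - (A - lam)² / M²) ^ 2` bounds the multiplicity
of `lam`, by Bessel's inequality for an orthonormal basis of the eigenspace. -/
theorem finrank_eigenspace_le_sum_norm_kernelFilter [Fintype V] (G : WGraph V E)
    (hG : G.IsBounded) (lam M : ℝ) (m : ℕ) :
    (Module.finrank ℂ (Module.End.eigenspace G.jacobi (lam : ℂ)) : ℝ) ≤
      ∑ x, ‖(kernelFilter (G.jacobiOp hG - algebraMap ℂ _ (lam : ℂ)) M ^ m) (delta x)‖ ^ 2 := by
  set B : ℓ²(V, ℂ) →L[ℂ] ℓ²(V, ℂ) := G.jacobiOp hG - algebraMap ℂ _ (lam : ℂ)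
  have hsa : IsSelfAdjoint B :=
    (G.isSelfAdjoint_jacobiOp hG).sub (IsSelfAdjoint.algebraMap _ (Complex.conj_ofReal lam))
  set R := kernelFilter B M ^ m
  have hR : IsSelfAdjoint R := (isSelfAdjoint_kernelFilter hsa M).pow m
  let coeL : ℓ²(V, ℂ) →ₗ[ℂ] (V → ℂ) :=
    { toFun := fun η => η, map_add' := fun _ _ => rfl, map_smul' := fun _ _ => rfl }
  have : FiniteDimensional ℂ ℓ²(V, ℂ) :=
    FiniteDimensional.of_injective coeL fun η ζ h => lp.ext h
  set K : Submodule ℂ ℓ²(V, ℂ) := LinearMap.ker (B : ℓ²(V, ℂ) →ₗ[ℂ] ℓ²(V, ℂ))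
  have hle : Module.finrank ℂ (Module.End.eigenspace G.jacobi (lam : ℂ)) ≤
      Module.finrank ℂ K := by
    let ι : Module.End.eigenspace G.jacobi (lam : ℂ) →ₗ[ℂ] K :=
      { toFun := fun f => ⟨⟨f.1, Memℓp.all _⟩, by
          change B _ = 0
          exact sub_eq_zero.2 (lp.ext (Module.End.mem_eigenspace_iff.1 f.2))⟩
        map_add' := fun _ _ => rfl
        map_smul' := fun _ _ => rfl }
    refine LinearMap.finrank_le_finrank_of_injective (f := ι) fun f g h => ?_
    have h' := congrArg (fun z : K => (z.1 : V → ℂ)) h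
    exact Subtype.ext h'
  refine (Nat.cast_le.2 hle).trans ?_
  let v := stdOrthonormalBasis ℂ K
  have hv : Orthonormal ℂ fun i => (v i : ℓ²(V, ℂ)) :=
    v.orthonormal.comp_linearIsometry K.subtypeₗᵢ
  have hRv : ∀ i, R (v i) = v i := fun i => kernelFilter_pow_apply_of_mem_ker (v i).2 M m
  have hbessel : ∀ x, ∑ i, ‖(v i : ℓ²(V, ℂ)) x‖ ^ 2 ≤ ‖R (delta x)‖ ^ 2 := by
    intro x
    refine le_trans (le_of_eq ?_) (hv.sum_inner_products_le (R (delta x)) (s := Finset.univ))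
    refine Finset.sum_congr rfl fun i _ => ?_
    have : inner ℂ (v i : ℓ²(V, ℂ)) (R (delta x)) = inner ℂ (v i : ℓ²(V, ℂ)) (delta x) := by
      have h := hR.isSymmetric (v i : ℓ²(V, ℂ)) (delta x)
      rw [ContinuousLinearMap.coe_coe, hRv] at h
      exact h.symm
    rw [this, ← inner_delta, norm_inner_symm]
  refine le_trans (le_of_eq ?_) (Finset.sum_le_sum fun x _ => hbessel x)
  rw [Finset.sum_comm]
  have hone : ∀ i, ∑ x, ‖(v i : ℓ²(V, ℂ)) x‖ ^ 2 = 1 := by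
    intro i
    have h := lp.norm_rpow_eq_tsum (p := 2) (by simp) (v i : ℓ²(V, ℂ))
    rw [hv.1 i, tsum_fintype] at h
    simpa using h.symm
  rw [Finset.sum_congr rfl fun i _ => hone i]
  simp

/-- Summed over the vertices of `G`, the filtered moments are at least `cc X - |∂X|`: in a finite
cover without short cycles this sum, times the degree, is a trace. -/
theorem cc_sub_boundary_le_sum_filterMoment [Fintype V] [Fintype E] (G : WGraph V E) {lam : ℝ}
    {X : Set V} (hX : (G.induce X).Acyclic)
    (h : ∀ C : G.Component X, ∃ f, G.IsLocalEigenfunction X lam C f) (M : ℝ) (m : ℕ) :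
    (G.cc X : ℝ) - (G.boundary X).ncard ≤ ∑ u, G.filterMoment lam M m u := by
  obtain ⟨V', E', _, _, H, p, N, hN, hsum, hH⟩ := G.exists_finite_covering ((m + m) * 2)
  have h₁ := p.mul_cc_sub_boundary_le_finrank hsum hX h
  have h₂ := H.finrank_eigenspace_le_sum_norm_kernelFilter p.isBounded lam M m
  rw [Finset.sum_congr rfl fun x _ => p.norm_kernelFilter_delta_sq p.isBounded lam M m hH x,
    hsum] at h₂
  exact le_of_mul_le_mul_left (h₁.trans h₂) (Nat.cast_pos.2 hN)

/-- The projections `y u` of the unit vectors at one vertex of `T` over each vertex `u` of `G` to the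
`lam`-eigenspace of the periodic Jacobi operator have squared norms summing to at least
`cc X - |∂X|`. -/
theorem exists_kernel_vectors [Fintype V] [Fintype E] {T : WGraph V' E'} {G : WGraph V E}
    (p : Covering T G) (hT : T.Acyclic) {lam : ℝ} {X : Set V} (hX : (G.induce X).Acyclic)
    (h : ∀ C : G.Component X, ∃ f, G.IsLocalEigenfunction X lam C f) (s : V → V')
    (hs : ∀ u, p.onV (s u) = u) :
    ∃ y : V → ℓ²(V', ℂ), (∀ u, periodicJacobi p (y u) = (lam : ℂ) • y u) ∧
      (∀ u, inner ℂ (y u) (delta (s u) - y u) = 0) ∧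
      (G.cc X : ℝ) - (G.boundary X).ncard ≤ ∑ u, ‖y u‖ ^ 2 := by
  set B : ℓ²(V', ℂ) →L[ℂ] ℓ²(V', ℂ) :=
    T.jacobiOp p.isBounded - algebraMap ℂ _ (lam : ℂ)
  have hsa : IsSelfAdjoint B := (T.isSelfAdjoint_jacobiOp p.isBounded).sub
    (IsSelfAdjoint.algebraMap _ (Complex.conj_ofReal lam))
  have hB : ∀ x, ‖B x‖ ≤ (‖B‖ + 1) * ‖x‖ := fun x =>
    (B.le_opNorm x).trans (by gcongr; linarith)
  choose y hy hyo hlim using fun u =>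
    exists_ker_tendsto_norm_kernelFilter hsa (by positivity) hB (delta (s u))
  refine ⟨y, fun u => sub_eq_zero.1 (hy u), hyo, ?_⟩
  refine ge_of_tendsto (tendsto_finsetSum Finset.univ fun u _ => hlim u)
    (Filter.Eventually.of_forall fun m => ?_)
  refine (G.cc_sub_boundary_le_sum_filterMoment hX h (‖B‖ + 1) m).trans (le_of_eq ?_)
  refine Finset.sum_congr rfl fun u _ => ?_
  rw [p.norm_kernelFilter_delta_sq p.isBounded lam _ m (hT.noCycleUpTo _), hs]

end UniversalCover

end WGraph

theorem mainTheorem3 {V E : Type*} [Fintype V] [Fintype E] (G : WGraph V E) (lam : ℝ)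
    (X : Set V) (hX : X ∈ G.aomotoFamily lam) :
    (Module.End.HasEigenvalue G.jacobi (lam : ℂ) ∧
      (G.cc X : ℤ) - (G.boundary X).ncard ≤
        Module.finrank ℂ (Module.End.eigenspace G.jacobi (lam : ℂ))) ∧
    ∀ {𝒱 ℰ : Type*} (T : WGraph 𝒱 ℰ) (p : WGraph.Covering T G)
      (hp : WGraph.IsUniversalCover p),
      Module.End.HasEigenvalue
        (WGraph.periodicJacobi p : ℓ²(𝒱, ℂ) →ₗ[ℂ] ℓ²(𝒱, ℂ)) (lam : ℂ) ∧
      (G.cc X : ℝ) - (G.boundary X).ncard ≤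
        Fintype.card V * (WGraph.densityOfStates p hp).real {lam} := by
  obtain ⟨hacyc, heig, hpos⟩ := hX
  have hloc := fun C => G.exists_isLocalEigenfunction X (lam : ℂ) C (heig C)
  have hdim := G.cc_sub_boundary_le_finrank X (lam : ℂ) hloc
  refine ⟨⟨fun hbot => ?_, hdim⟩, fun T p hp => ?_⟩
  · have h0 : Module.finrank ℂ (Module.End.eigenspace G.jacobi (lam : ℂ)) = 0 := by
      change Module.End.eigenspace G.jacobi (lam : ℂ) = ⊥ at hbot
      rw [hbot, finrank_bot]
    omega
  have hsurj := p.surjective hp.isTree.1 hp.connected_base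
  obtain ⟨y, hy, hyo, hsum⟩ := WGraph.exists_kernel_vectors p hp.isTree.2 hacyc hloc
    (Function.surjInv hsurj) (Function.surjInv_eq hsurj)
  have hposR : (0 : ℝ) < (G.cc X : ℝ) - (G.boundary X).ncard := by exact_mod_cast hpos
  constructor
  · obtain ⟨u, -, hu⟩ := Finset.exists_ne_zero_of_sum_ne_zero (hposR.trans_le hsum).ne'
    refine Module.End.hasEigenvalue_of_hasEigenvector (x := y u)
      ⟨Module.End.mem_eigenspace_iff.2 (hy u), fun h0 => hu ?_⟩
    rw [h0]; simp
  · refine hsum.trans ?_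
    have hV : Nonempty V := hp.connected_base.nonempty
    have hcard : (Fintype.card V : ℝ) ≠ 0 := Nat.cast_ne_zero.2 Fintype.card_ne_zero
    set μ : V → MeasureTheory.Measure ℝ := fun u =>
      spectralMeasure (WGraph.periodicJacobi p) (T.isSelfAdjoint_jacobiOp p.isBounded)
        (WGraph.delta (Function.surjInv hsurj u))
    have hfin : ∀ u, μ u {lam} ≠ ∞ := fun u => by
      have : (μ u).Regular := RealRMK.regular_rieszMeasure _
      exact isCompact_singleton.measure_lt_top.ne
    have hreal : (Fintype.card V : ℝ) * (WGraph.densityOfStates p hp).real {lam} =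
        ∑ u, (μ u).real {lam} := by
      have : WGraph.densityOfStates p hp = (Fintype.card V : ℝ≥0∞)⁻¹ • ∑ u, μ u := rfl
      rw [this, MeasureTheory.measureReal_ennreal_smul_apply, ENNReal.toReal_inv,
        ENNReal.toReal_natCast, mul_inv_cancel_left₀ hcard, MeasureTheory.measureReal_def,
        MeasureTheory.Measure.finsetSum_apply, ENNReal.toReal_sum fun u _ => hfin u]
      rfl
    rw [hreal]
    refine Finset.sum_le_sum fun u _ => ?_
    exact (ENNReal.ofReal_le_iff_le_toReal (hfin u)).1
      (ofReal_norm_sq_le_spectralMeasure _ (hy u) (hyo u))
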